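/- Let $d_1=d_1(a)$, $k_1=k_1(a)$, $d=d(a)$, $N=N(a)$ be sequences of positive integers ($a\to\infty$) such that $k_1d_1=o(N)$, $N=o(k_1d)$, $d^2\log d=o(N^2)$, $d_1\mid d$ and $d\mid N$. Let $\mathcal P$ be the lazy random walk on the $N\times N$ torus $(\mathbb Z/N\mathbb Z)^2$, which stays put with probability $1/5$ and moves to each of the four neighbours $(x_1\pm1,x_2)$, $(x_1,x_2\pm1)$ with probability $1/5$; its stationary distribution $\pi$ is uniform. Let the marked set be $M=M_1\cup M_2$ with $$M_1=\{(j_1d_1,j_2d_1)\mid 0\le j_1,j_2\le k_1-1\},\qquad M_2=\{(j_1d,j_2d)\mid 0\le j_1,j_2<N/d\},$$ and let $U$ be its complement. The hitting time is $HT=\mathbb E[Z]$, where $Z$ is the first time $t\ge 0$ at which the walk started from $\pi$ is in $M$. The extended hitting time is $HT^+=\lim_{s\to1^-}HT(s)$, where $$HT(s)=\frac1{1-p_M}\sum_{k:\,\lambda_k(s)\ne1}\frac{|\langle v_k(s),\sqrt{\pi_U}\rangle|^2}{1-\lambda_k(s)},\qquad p_M=\sum_{x\in M}\pi_x,\qquad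 \sqrt{\pi_U}=\sum_{x\in U}\sqrt{\pi_x}\,e_x .$$ Here $e_x$ are the standard basis vectors, $(v_k(s))_k$ is an orthonormal eigenbasis, with eigenvalues $\lambda_k(s)$, of the symmetric matrix $D(s)$ with entries $D(s)_{xy}=\sqrt{\mathcal P(s)_{xy}\mathcal P(s)_{yx}}$, where $\mathcal P(s)=(1-s)\mathcal P+s\mathcal P'$ and $\mathcal P'$ is obtained from $\mathcal P$ by making all states of $M$ absorbing. Then, as $a\to\infty$, the limit defining $HT^+$ exists for all sufficiently large $a$, and $$HT^+=\Omega(N^2),\qquad HT=O(d^2\log d)=o(HT^+).$$ Moreover, a gap of order $\widetilde\Omega(N^2)$ occurs: for $a\ge2$ the parameters $d_1=1$, $k_1=a\,2^{a^2}$, $d=a^2$, $N=a^2\,2^{a^2}$ satisfy the above conditions, and for them, for all sufficiently large $a$, $HT>0$ and $$\frac{HT^+}{HT}\ \ge\ c\,\frac{N^2}{\log^2N\,\log\log N}$$ with a constant $c>0$. -/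

import Mathlib

open Filter Topology Asymptotics MeasureTheory ProbabilityTheory
open scoped ENNReal

namespace SpatialSearch

section Chains

variable {X : Type*} [Fintype X] [DecidableEq X]

/-- A reversible Markov chain on a finite state space: an ergodic row-stochastic transition
matrix `P` together with its stationary distribution `π`, satisfying detailed balance.
(Detailed balance and `∑ π = 1` make `π` a stationary distribution, and ergodicity makes it
the only one.) -/
structure ReversibleChain (X : Type*) [Fintype X] [DecidableEq X] where
  P : Matrix X X ℝ
  π : X → ℝ
  P_nonneg : ∀ x y, 0 ≤ P x y
  P_sum : ∀ x, ∑ y, P x y = 1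
  ergodic : ∃ t : ℕ, ∀ x y, (P ^ t) x y ≠ 0
  π_nonneg : ∀ x, 0 ≤ π x
  π_sum : ∑ x, π x = 1
  detailed_balance : ∀ x y, π x * P x y = π y * P y x

namespace ReversibleChain

variable (C : ReversibleChain X)

/-- The stationary distribution as a `PMF`. -/
noncomputable def initPMF : PMF X :=
  PMF.ofFintype (fun x => ENNReal.ofReal (C.π x)) (by
    rw [← ENNReal.ofReal_sum_of_nonneg fun x _ => C.π_nonneg x, C.π_sum, ENNReal.ofReal_one])

/-- One step of the chain from `x`, as a `PMF`. -/
noncomputable def stepPMF (x : X) : PMF X :=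
  PMF.ofFintype (fun y => ENNReal.ofReal (C.P x y)) (by
    rw [← ENNReal.ofReal_sum_of_nonneg fun y _ => C.P_nonneg x y, C.P_sum, ENNReal.ofReal_one])

section Path

variable [MeasurableSpace X] [MeasurableSingletonClass X]

/-- The transition kernel of the chain. -/
noncomputable def stepKernel : Kernel X X :=
  Kernel.ofFunOfCountable fun x => (C.stepPMF x).toMeasure

instance : IsMarkovKernel C.stepKernel :=
  ⟨fun x => inferInstanceAs (IsProbabilityMeasure (C.stepPMF x).toMeasure)⟩

/-- The law of the trajectory `(Y₀, Y₁, Y₂, …)` of the chain started from its stationary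
distribution: `Y₀ ∼ π`, and given `Y₀, …, Yₙ` the state `Yₙ₊₁` has law `P (Yₙ) ·`. -/
noncomputable def pathMeasure : Measure (ℕ → X) :=
  Kernel.trajMeasure (X := fun _ => X) C.initPMF.toMeasure fun n =>
    C.stepKernel.comap (fun h : (i : Finset.Iic n) → X => h ⟨n, Finset.mem_Iic.2 le_rfl⟩)
      (measurable_pi_apply _)

/-- The hitting time `HT = 𝔼[Z]`, where `Z` is the first time (possibly infinite) at which the
chain, started from its stationary distribution, is in the marked set `M`. -/
noncomputable def hittingTime (M : Finset X) : ℝ≥0∞ :=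
  ∫⁻ ω, ENat.toENNReal (hittingAfter (fun t (ω : ℕ → X) => ω t) (M : Set X) 0 ω) ∂C.pathMeasure

end Path

variable (M : Finset X)

/-- The probability that a stationary state is marked. -/
noncomputable def markedProb : ℝ := ∑ x ∈ M, C.π x

/-- The absorbing walk: as the chain on unmarked states, and staying put on marked states. -/
def absorbing : Matrix X X ℝ :=
  Matrix.of fun x y => if x ∈ M then (if x = y then 1 else 0) else C.P x y

/-- The interpolated walk `P(s) = (1 - s) P + s P'`. -/
def interpolated (s : ℝ) : Matrix X X ℝ := (1 - s) • C.P + s • C.absorbing M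

/-- The discriminant matrix `D(s)` of the (reversible) interpolated walk. -/
noncomputable def discriminant (s : ℝ) : Matrix X X ℝ :=
  Matrix.of fun x y => √(C.interpolated M s x y * C.interpolated M s y x)

theorem discriminant_isHermitian (s : ℝ) : (C.discriminant M s).IsHermitian := by
  ext x y
  simp [discriminant, mul_comm]

/-- The vector `√π_U`, supported on the unmarked states. -/
noncomputable def sqrtUnmarked : EuclideanSpace ℝ X :=
  WithLp.toLp 2 fun x => if x ∈ M then 0 else √(C.π x)

/-- `HT(s) = (1 - p_M)⁻¹ ∑_k |⟨v_k(s), √π_U⟩|² / (1 - λ_k(s))`, the sum running over an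
orthonormal eigenbasis of `D(s)` without the eigenvector of eigenvalue `1`. -/
noncomputable def interpolatedHT (s : ℝ) : ℝ :=
  1 / (1 - C.markedProb M) *
    ∑ k with (C.discriminant_isHermitian M s).eigenvalues k ≠ 1,
      (inner ℝ ((C.discriminant_isHermitian M s).eigenvectorBasis k) (C.sqrtUnmarked M)) ^ 2 /
        (1 - (C.discriminant_isHermitian M s).eigenvalues k)

/-- The extended hitting time `HT⁺ = lim_{s → 1⁻} HT(s)`. -/
noncomputable def extendedHT : ℝ := limUnder (𝓝[<] (1 : ℝ)) (C.interpolatedHT M)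

end ReversibleChain

end Chains

section Torus

/-- Vertices of the `N × N` torus. -/
abbrev Vertex (N : ℕ) : Type := ZMod N × ZMod N

/-- Transition matrix of the lazy walk on the torus: with probability `1/5` each, stay or move to
one of the four neighbours (contributions add up where these coincide, i.e. for `N ≤ 2`). -/
noncomputable def torusMatrix (N : ℕ) : Matrix (Vertex N) (Vertex N) ℝ :=
  Matrix.of fun x y =>
    ((if y = x then 1 else 0) + (if y = x + (1, 0) then 1 else 0) +
      (if y = x - (1, 0) then 1 else 0) + (if y = x + (0, 1) then 1 else 0) +
      (if y = x - (0, 1) then 1 else 0)) / 5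

theorem torusMatrix_nonneg (N : ℕ) (x y : Vertex N) : 0 ≤ torusMatrix N x y := by
  simp only [torusMatrix, Matrix.of_apply]
  positivity

theorem torusMatrix_symm (N : ℕ) (x y : Vertex N) : torusMatrix N x y = torusMatrix N y x := by
  simp only [torusMatrix, Matrix.of_apply]
  have h0 : (y = x) = (x = y) := propext eq_comm
  have h1 : ∀ v : Vertex N, (x = y - v) = (y = x + v) := fun v =>
    propext (by rw [eq_sub_iff_add_eq, eq_comm])
  have h2 : ∀ v : Vertex N, (x = y + v) = (y = x - v) := fun v =>
    propext (by rw [← sub_eq_iff_eq_add, eq_comm])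
  simp only [h0, h1, h2]
  ring

theorem torusMatrix_self_pos (N : ℕ) (x : Vertex N) : 0 < torusMatrix N x x := by
  simp only [torusMatrix, Matrix.of_apply, if_true]
  positivity

theorem torusMatrix_right_pos (N : ℕ) (x : Vertex N) : 0 < torusMatrix N x (x + (1, 0)) := by
  simp only [torusMatrix, Matrix.of_apply, if_true]
  positivity

theorem torusMatrix_up_pos (N : ℕ) (x : Vertex N) : 0 < torusMatrix N x (x + (0, 1)) := by
  simp only [torusMatrix, Matrix.of_apply, if_true]
  positivity

variable (N : ℕ) [NeZero N]

theorem torusMatrix_sum (x : Vertex N) : ∑ y, torusMatrix N x y = 1 := by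
  simp only [torusMatrix, Matrix.of_apply]
  rw [← Finset.sum_div]
  simp only [Finset.sum_add_distrib, Finset.sum_ite_eq', Finset.mem_univ, if_true]
  norm_num

theorem torusMatrix_pow_nonneg (t : ℕ) (x y : Vertex N) : 0 ≤ (torusMatrix N ^ t) x y := by
  induction t generalizing x y with
  | zero => rw [pow_zero, Matrix.one_apply]; positivity
  | succ t ih =>
    rw [pow_succ, Matrix.mul_apply]
    exact Finset.sum_nonneg fun z _ => mul_nonneg (ih x z) (torusMatrix_nonneg N z y)

theorem torusMatrix_pow_succ_pos {t : ℕ} {x y z : Vertex N} (h : 0 < (torusMatrix N ^ t) x y)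
    (hyz : 0 < torusMatrix N y z) : 0 < (torusMatrix N ^ (t + 1)) x z := by
  rw [pow_succ, Matrix.mul_apply]
  exact lt_of_lt_of_le (mul_pos h hyz) (Finset.single_le_sum
    (f := fun w => (torusMatrix N ^ t) x w * torusMatrix N w z)
    (fun w _ => mul_nonneg (torusMatrix_pow_nonneg N t x w) (torusMatrix_nonneg N w z))
    (Finset.mem_univ y))

theorem torusMatrix_pow_pos (x y : Vertex N) : 0 < (torusMatrix N ^ (2 * N)) x y := by
  have h1 : ∀ a : ℕ, 0 < (torusMatrix N ^ a) x (x + ((a : ZMod N), 0)) := by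
    intro a
    induction a with
    | zero => rw [pow_zero, Nat.cast_zero, Prod.mk_zero_zero, add_zero, Matrix.one_apply_eq]; exact one_pos
    | succ a ih =>
      have := torusMatrix_pow_succ_pos N ih (torusMatrix_right_pos N _)
      simpa [add_assoc] using this
  have h2 : ∀ a b : ℕ, 0 < (torusMatrix N ^ (a + b)) x (x + ((a : ZMod N), (b : ZMod N))) := by
    intro a b
    induction b with
    | zero => simpa using h1 a
    | succ b ih =>
      have := torusMatrix_pow_succ_pos N ih (torusMatrix_up_pos N _)
      simpa [add_assoc] using this
  have h3 : ∀ t c : ℕ, 0 < (torusMatrix N ^ t) x y → 0 < (torusMatrix N ^ (t + c)) x y := by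
    intro t c h
    induction c with
    | zero => exact h
    | succ c ih => exact torusMatrix_pow_succ_pos N ih (torusMatrix_self_pos N y)
  have hy : x + ((((y - x).1.val : ℕ) : ZMod N), (((y - x).2.val : ℕ) : ZMod N)) = y := by
    simp only [ZMod.natCast_val, ZMod.cast_id', id_eq]
    exact add_sub_cancel x y
  have h4 := h2 (y - x).1.val (y - x).2.val
  rw [hy] at h4
  have l1 := ZMod.val_lt (y - x).1
  have l2 := ZMod.val_lt (y - x).2
  have h5 := h3 _ (2 * N - ((y - x).1.val + (y - x).2.val)) h4
  rwa [Nat.add_sub_cancel' (by omega)] at h5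

/-- The lazy random walk on the `N × N` torus, with its uniform stationary distribution. -/
noncomputable def torusWalk : ReversibleChain (Vertex N) where
  P := torusMatrix N
  π := fun _ => 1 / (N : ℝ) ^ 2
  P_nonneg := torusMatrix_nonneg N
  P_sum := torusMatrix_sum N
  ergodic := ⟨2 * N, fun x y => (torusMatrix_pow_pos N x y).ne'⟩
  π_nonneg := fun _ => by positivity
  π_sum := by
    have : (N : ℝ) ≠ 0 := Nat.cast_ne_zero.2 (NeZero.ne N)
    simp [Fintype.card_prod, ZMod.card]
    field_simp
  detailed_balance := fun x y => by rw [torusMatrix_symm]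

/-- The `k × k` subgrid `{(j₁ e, j₂ e) | 0 ≤ j₁, j₂ < k}` with spacing `e`. -/
def subgrid (k e : ℕ) : Finset (Vertex N) :=
  (Finset.range k ×ˢ Finset.range k).image fun j =>
    (((j.1 * e : ℕ) : ZMod N), ((j.2 * e : ℕ) : ZMod N))

/-- The marked set: a dense `k₁ × k₁` subgrid with spacing `d₁`, and a sparse subgrid with
spacing `d` that spreads over the whole torus. -/
def markedSet (d₁ k₁ d : ℕ) : Finset (Vertex N) := subgrid N k₁ d₁ ∪ subgrid N (N / d) d

end Torus

/-- The parameter regime, for sequences of positive integers. -/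
structure GapRegime (d₁ k₁ d N : ℕ → ℕ+) : Prop where
  dense_small : (fun a => ((k₁ a : ℕ) : ℝ) * ((d₁ a : ℕ) : ℝ)) =o[atTop]
    fun a => ((N a : ℕ) : ℝ)
  sparse_few : (fun a => ((N a : ℕ) : ℝ)) =o[atTop]
    fun a => ((k₁ a : ℕ) : ℝ) * ((d a : ℕ) : ℝ)
  sparse_hit : (fun a => ((d a : ℕ) : ℝ) ^ 2 * Real.log ((d a : ℕ) : ℝ)) =o[atTop]
    fun a => ((N a : ℕ) : ℝ) ^ 2
  dvd_sparse : ∀ a, (d₁ a : ℕ) ∣ (d a : ℕ)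
  dvd_size : ∀ a, (d a : ℕ) ∣ (N a : ℕ)

/-- Classical hitting time of the marked set on the `N × N` torus. -/
noncomputable def gridHT (d₁ k₁ d N : ℕ+) : ℝ≥0∞ :=
  (torusWalk N).hittingTime (markedSet N d₁ k₁ d)

/-- The quantities `HT(s)` for the marked set on the `N × N` torus. -/
noncomputable def gridInterpolatedHT (d₁ k₁ d N : ℕ+) (s : ℝ) : ℝ :=
  (torusWalk N).interpolatedHT (markedSet N d₁ k₁ d) s

/-- Extended hitting time of the marked set on the `N × N` torus. -/
noncomputable def gridExtendedHT (d₁ k₁ d N : ℕ+) : ℝ :=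
  (torusWalk N).extendedHT (markedSet N d₁ k₁ d)

end SpatialSearch

/-! Upper bound on `HT`. Reduction mod `d` maps the walk on the `N × N` torus to the walk on the `d
× d` torus, and the sparse grid contains the fibre over `0`. So `HT` is at most the largest expected
time to reach `0` on the small torus. That time is the explicit character sum `torusGreen`, which
satisfies `g = 1 + P g` away from `0` (`torusGreen_laplacian`); a supermartingale argument
(`hittingTime_le`) turns it into a bound. The spectral gap at frequency `k` is at least of order
`|k|² / d²`, so the sum is at most of order `d² ∑ |k|⁻²`, hence `O(d² log d)` (`torusGreen_le`).

Lower bound on `HT⁺`. Let `n` be the number of vertices and `m = |M|`. As `P` is symmetric, `1 -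
D(s) = S (1 - P) S` with `S` diagonal, so the spectral sum reduces to the Poisson equation `(1 - P)
h = b` with `b = m - n 1_M`. It equals an explicit factor times `⟨b, h⟩`, and the only
`s`-dependence is in that factor (`interpolatedHT_eq`); hence the limit exists. Dirichlet's
principle (`sq_sum_le_energy`) bounds `⟨b, h⟩` below by `⟨b, φ⟩²` over the energy of any nonconstant
test function `φ`. Take for `φ` the cyclic distance of the first coordinate to `0`: its energy is
`O(N²)`, its average over the torus is at least `N / 8`, but over `M` at most `N / 16`, since most
marked vertices lie in the small dense grid near the origin. This yields `HT⁺ ≥ N² / 128`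
(`extendedHT_lower_bound`).

Thus the sparse grid makes classical hitting fast, while `HT⁺` measures how far the uniform
distribution on `M` is from that on the whole torus. -/

namespace SpatialSearch
namespace ReversibleChain

/-! ### Hitting times on path space -/

section Hitting

variable {X : Type*} [Fintype X] [DecidableEq X] [MeasurableSpace X] [MeasurableSingletonClass X]
  (C : ReversibleChain X)

instance : IsProbabilityMeasure C.pathMeasure := by
  unfold pathMeasure; infer_instance

theorem lintegral_stepKernel (x : X) (f : X → ℝ≥0∞) :
    ∫⁻ y, f y ∂(C.stepKernel x) = ∑ y, ENNReal.ofReal (C.P x y) * f y := by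
  have h : C.stepKernel x = (C.stepPMF x).toMeasure := rfl
  rw [h, lintegral_fintype]
  refine Finset.sum_congr rfl fun y _ => ?_
  rw [PMF.toMeasure_apply_singleton _ _ (measurableSet_singleton y), mul_comm]
  rfl

/-- The Markov property: a function of the past times a function of the next state. -/
theorem lintegral_mul_succ (t : ℕ) (F : ((i : Finset.Iic t) → X) → ℝ≥0∞) (g : X → ℝ≥0∞) :
    ∫⁻ ω, F (Preorder.frestrictLe t ω) * g (ω (t + 1)) ∂C.pathMeasure =
      ∫⁻ ω, F (Preorder.frestrictLe t ω) * ∑ y, ENNReal.ofReal (C.P (ω t) y) * g y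
        ∂C.pathMeasure := by
  have hg : Measurable g := measurable_of_finite g
  set κ : (n : ℕ) → Kernel ((i : Finset.Iic n) → X) X := fun n =>
    C.stepKernel.comap (fun h : (i : Finset.Iic n) → X => h ⟨n, Finset.mem_Iic.2 le_rfl⟩)
      (measurable_pi_apply _) with hκ
  have key : C.pathMeasure.map (Preorder.frestrictLe t) ⊗ₘ κ t =
      C.pathMeasure.map (fun x => (Preorder.frestrictLe t x, x (t + 1))) :=
    Kernel.map_frestrictLe_trajMeasure_compProd_eq_map_trajMeasure (X := fun _ => X)
  have hm : Measurable fun q : ((i : Finset.Iic t) → X) × X => F q.1 * g q.2 := by fun_prop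
  have h1 : ∫⁻ q, F q.1 * g q.2 ∂(C.pathMeasure.map (Preorder.frestrictLe t) ⊗ₘ κ t) =
      ∫⁻ q, F q.1 * g q.2
        ∂(C.pathMeasure.map fun x => (Preorder.frestrictLe t x, x (t + 1))) := by
    rw [key]
  rw [lintegral_map hm (by fun_prop), Measure.lintegral_compProd hm,
    lintegral_map (measurable_of_finite _) (by fun_prop)] at h1
  rw [← h1]
  refine lintegral_congr fun ω => ?_
  have e : κ t (Preorder.frestrictLe t ω) = C.stepKernel (ω t) := Kernel.comap_apply _ _ _
  have e1 : ∫⁻ b, F (Preorder.frestrictLe t ω) * g b ∂(C.stepKernel (ω t)) =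
      F (Preorder.frestrictLe t ω) * ∑ y, ENNReal.ofReal (C.P (ω t) y) * g y := by
    rw [lintegral_const_mul _ hg, lintegral_stepKernel]
  exact (congrArg (fun μ => ∫⁻ b, F (Preorder.frestrictLe t ω) * g b ∂μ) e).trans e1

omit [Fintype X] [MeasurableSpace X] [MeasurableSingletonClass X] in
-- Layer-cake formula `Z = ∑ₜ 1[Z > t]`; it also holds when `M` is never hit, both sides being `⊤`.
theorem toENNReal_hittingAfter (M : Finset X) (ω : ℕ → X) :
    ENat.toENNReal (hittingAfter (fun t (ω : ℕ → X) => ω t) (M : Set X) 0 ω) =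
      ∑' t : ℕ, if ∀ i ≤ t, ω i ∉ M then (1 : ℝ≥0∞) else 0 := by
  classical
  by_cases h : ∃ j, ω j ∈ M
  · have hZ : hittingAfter (fun t (ω : ℕ → X) => ω t) (M : Set X) 0 ω =
        ((Nat.find h : ℕ) : WithTop ℕ) := by
      apply le_antisymm
      · exact hittingAfter_le_of_mem (Nat.zero_le _) (Nat.find_spec h)
      · by_contra! hlt
        obtain ⟨j, hj, hjM⟩ := hittingAfter_lt_iff.1 hlt
        exact Nat.find_min h hj.2 hjM
    have hsum : ∀ t, (∀ i ≤ t, ω i ∉ M) ↔ t ∈ Finset.range (Nat.find h) := by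
      intro t
      rw [Finset.mem_range, Nat.lt_find_iff]
    refine (congrArg ENat.toENNReal hZ).trans ((ENat.toENNReal_coe _).trans ?_)
    simp only [hsum]
    rw [tsum_eq_sum (s := Finset.range (Nat.find h)) (fun t ht => if_neg ht),
      Finset.sum_congr rfl (fun t ht => if_pos ht)]
    simp
  · push Not at h
    have hZ : hittingAfter (fun t (ω : ℕ → X) => ω t) (M : Set X) 0 ω = (⊤ : WithTop ℕ) :=
      hittingAfter_eq_top_iff.2 fun j _ => h j
    have hsum : ∀ t, (if ∀ i ≤ t, ω i ∉ M then (1 : ℝ≥0∞) else 0) = 1 := fun t =>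
      if_pos fun i _ => h i
    rw [tsum_congr hsum, ENNReal.tsum_const_eq_top_of_ne_zero one_ne_zero]
    exact (congrArg ENat.toENNReal hZ).trans ENat.toENNReal_top

theorem measurable_avoid (M : Finset X) (t : ℕ) :
    Measurable fun ω : ℕ → X => if ∀ i ≤ t, ω i ∉ M then (1 : ℝ≥0∞) else 0 := by
  refine Measurable.ite ?_ measurable_const measurable_const
  have : {ω : ℕ → X | ∀ i ≤ t, ω i ∉ M} = ⋂ i, ⋂ (_ : i ≤ t), (fun ω : ℕ → X => ω i) ⁻¹' (M : Set X)ᶜ := by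
    ext ω; simp
  rw [this]
  exact MeasurableSet.iInter fun i => MeasurableSet.iInter fun _ =>
    measurable_pi_apply i (Set.toFinite _).measurableSet

theorem hittingTime_eq_tsum (M : Finset X) :
    C.hittingTime M = ∑' t : ℕ, ∫⁻ ω, (if ∀ i ≤ t, ω i ∉ M then (1 : ℝ≥0∞) else 0) ∂C.pathMeasure := by
  unfold hittingTime
  rw [lintegral_congr (toENNReal_hittingAfter M),
    lintegral_tsum fun t => (measurable_avoid M t).aemeasurable]

/-- A bounded function `g` with `g ≥ 1 + P g` outside of `M` bounds the hitting time of `M`. -/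
theorem hittingTime_le (M : Finset X) (g : X → ℝ≥0∞) (B : ℝ≥0∞)
    (hg : ∀ x ∉ M, 1 + ∑ y, ENNReal.ofReal (C.P x y) * g y ≤ g x) (hB : ∀ x, g x ≤ B) :
    C.hittingTime M ≤ B := by
  rw [hittingTime_eq_tsum]
  set V : ℕ → (ℕ → X) → ℝ≥0∞ := fun t ω => if ∀ i ≤ t, ω i ∉ M then 1 else 0 with hV
  have hVm : ∀ t, Measurable (V t) := measurable_avoid M
  -- The value of `g` at time `t`, restricted to paths not yet absorbed, loses at least `P(Z > t)`
  -- in each step. Telescoping bounds every partial sum of `∑ₜ P(Z > t)` by the initial value.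
  have step : ∀ t, ∫⁻ ω, V t ω ∂C.pathMeasure + ∫⁻ ω, V (t + 1) ω * g (ω (t + 1)) ∂C.pathMeasure ≤
      ∫⁻ ω, V t ω * g (ω t) ∂C.pathMeasure := by
    intro t
    have h1 : ∫⁻ ω, V (t + 1) ω * g (ω (t + 1)) ∂C.pathMeasure ≤
        ∫⁻ ω, V t ω * g (ω (t + 1)) ∂C.pathMeasure := by
      refine lintegral_mono fun ω => mul_le_mul_left ?_ _
      simp only [hV]
      split_ifs with ha hb
      · exact le_rfl
      · exact absurd (fun i hi => ha i (hi.trans t.le_succ)) hb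
      · exact zero_le
      · exact le_rfl
    have h2 := C.lintegral_mul_succ t
      (fun h => if ∀ i : Finset.Iic t, h i ∉ M then 1 else 0) g
    have h3 : ∀ ω : ℕ → X, (if ∀ i : Finset.Iic t, Preorder.frestrictLe (π := fun _ => X) t ω i ∉ M
        then (1 : ℝ≥0∞) else 0) = V t ω := by
      intro ω
      simp only [hV]
      refine if_congr ?_ rfl rfl
      exact ⟨fun h i hi => h ⟨i, Finset.mem_Iic.2 hi⟩, fun h i => h i (Finset.mem_Iic.1 i.2)⟩
    simp only [h3] at h2
    calc _ ≤ ∫⁻ ω, V t ω ∂C.pathMeasure + ∫⁻ ω, V t ω * g (ω (t + 1)) ∂C.pathMeasure := by gcongr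
      _ = ∫⁻ ω, (V t ω + V t ω * ∑ y, ENNReal.ofReal (C.P (ω t) y) * g y) ∂C.pathMeasure := by
        rw [h2, lintegral_add_left (hVm t)]
      _ ≤ _ := by
        refine lintegral_mono fun ω => ?_
        simp only [hV]
        split_ifs with ha
        · simpa using hg (ω t) (ha t le_rfl)
        · simp
  have tel : ∀ T, ∑ t ∈ Finset.range T, ∫⁻ ω, V t ω ∂C.pathMeasure +
      ∫⁻ ω, V T ω * g (ω T) ∂C.pathMeasure ≤ B := by
    intro T
    induction T with
    | zero =>
      rw [Finset.sum_range_zero, zero_add]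
      calc _ ≤ ∫⁻ _, B ∂C.pathMeasure := by
            refine lintegral_mono fun ω => ?_
            simp only [hV]
            split_ifs
            · simpa using hB _
            · simp
        _ = B := by simp
    | succ T ih =>
      rw [Finset.sum_range_succ, add_assoc]
      exact (add_le_add le_rfl (step T)).trans ih
  refine ENNReal.tsum_le_of_sum_range_le fun T => le_trans le_self_add (tel T)

/-- Identifies the law at time `0`; this is what makes `HT` strictly positive, via `P(Z > 0)`. -/
theorem map_zero_pathMeasure : C.pathMeasure.map (fun ω => ω 0) = C.initPMF.toMeasure := by
  unfold pathMeasure Kernel.trajMeasure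
  have h0 : (fun ω : ℕ → X => ω 0) = (MeasurableEquiv.piUnique (fun _ : Finset.Iic 0 => X)) ∘
      (Preorder.frestrictLe (π := fun _ => X) 0) := rfl
  rw [h0, ← Measure.map_map (by fun_prop) (by fun_prop), Measure.map_comp _ _ (by fun_prop),
    Kernel.traj_map_frestrictLe, Kernel.partialTraj_self, Measure.id_comp,
    Measure.map_map (by fun_prop) (by fun_prop)]
  convert Measure.map_id
  ext x
  simp

/-- The hitting time is at least the stationary mass of any unmarked state. -/
theorem le_hittingTime (M : Finset X) {x : X} (hx : x ∉ M) :
    ENNReal.ofReal (C.π x) ≤ C.hittingTime M := by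
  rw [hittingTime_eq_tsum]
  refine le_trans ?_ (ENNReal.le_tsum 0)
  have h1 : ENNReal.ofReal (C.π x) = C.pathMeasure ((fun ω : ℕ → X => ω 0) ⁻¹' {x}) := by
    rw [← Measure.map_apply (by fun_prop) (measurableSet_singleton x), map_zero_pathMeasure,
      PMF.toMeasure_apply_singleton _ _ (measurableSet_singleton x)]
    rfl
  rw [h1, ← lintegral_indicator_one (measurable_pi_apply 0 (measurableSet_singleton x))]
  refine lintegral_mono fun ω => ?_
  by_cases h : ω 0 = x
  · simp [h, hx]
  · simp [h]

end Hitting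

end ReversibleChain
end SpatialSearch

namespace SpatialSearch

/-! ### Dirichlet forms of symmetric stochastic matrices -/

section Energy

variable {X : Type*} [Fintype X] {Q : Matrix X X ℝ}

/-- Summation by parts. The factor `2` arises because each unordered pair is counted twice. -/
theorem sum_energy (hs : ∀ x y, Q x y = Q y x) (h1 : ∀ x, ∑ y, Q x y = 1) (f h : X → ℝ) :
    ∑ x, ∑ y, Q x y * ((f x - f y) * (h x - h y)) = 2 * ∑ x, f x * (h x - ∑ y, Q x y * h y) := by
  have e1 : ∑ x, ∑ y, Q x y * (f x * h x) = ∑ x, f x * h x := by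
    refine Finset.sum_congr rfl fun x _ => ?_
    rw [← Finset.sum_mul, h1, one_mul]
  have e2 : ∑ x, ∑ y, Q x y * (f y * h y) = ∑ x, f x * h x := by
    rw [Finset.sum_comm, ← e1]
    exact Finset.sum_congr rfl fun x _ => Finset.sum_congr rfl fun y _ => by rw [hs]
  have e3 : ∑ x, ∑ y, Q x y * (f x * h y) = ∑ x, f x * ∑ y, Q x y * h y := by
    refine Finset.sum_congr rfl fun x _ => ?_
    rw [Finset.mul_sum]
    exact Finset.sum_congr rfl fun y _ => by ring
  have e4 : ∑ x, ∑ y, Q x y * (f y * h x) = ∑ x, f x * ∑ y, Q x y * h y := by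
    rw [Finset.sum_comm, ← e3]
    exact Finset.sum_congr rfl fun x _ => Finset.sum_congr rfl fun y _ => by rw [hs]
  have e5 : ∀ x y, Q x y * ((f x - f y) * (h x - h y)) =
      Q x y * (f x * h x) + Q x y * (f y * h y) - Q x y * (f x * h y) - Q x y * (f y * h x) :=
    fun x y => by ring
  simp_rw [e5]
  simp only [Finset.sum_sub_distrib, Finset.sum_add_distrib, mul_sub, e1, e2, e3, e4]
  ring

/-- Dirichlet's principle: the energy of `φ` bounds `⟨b, φ⟩²` for `b = (1 - Q) h`. -/
theorem sq_sum_le_energy (hs : ∀ x y, Q x y = Q y x) (h1 : ∀ x, ∑ y, Q x y = 1)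
    (h0 : ∀ x y, 0 ≤ Q x y) {b h : X → ℝ} (hb : ∀ x, h x - ∑ y, Q x y * h y = b x) (φ : X → ℝ) :
    (∑ x, b x * φ x) ^ 2 ≤ (∑ x, b x * h x) * ((∑ x, ∑ y, Q x y * (φ x - φ y) ^ 2) / 2) := by
  have e1 := sum_energy hs h1 φ h
  have e2 := sum_energy hs h1 h h
  simp only [hb] at e1 e2
  have e3 : ∑ x, b x * φ x = (∑ p : X × X, Q p.1 p.2 * ((φ p.1 - φ p.2) * (h p.1 - h p.2))) / 2 := by
    rw [Fintype.sum_prod_type, e1]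
    simp only [mul_comm (φ _)]
    ring
  have e4 : ∑ x, b x * h x = (∑ p : X × X, Q p.1 p.2 * ((h p.1 - h p.2) * (h p.1 - h p.2))) / 2 := by
    rw [Fintype.sum_prod_type, e2]
    simp only [mul_comm (h _)]
    ring
  have e5 : (∑ x, ∑ y, Q x y * (φ x - φ y) ^ 2) = ∑ p : X × X, Q p.1 p.2 * (φ p.1 - φ p.2) ^ 2 := by
    rw [Fintype.sum_prod_type]
  have cs := Finset.sum_sq_le_sum_mul_sum_of_sq_le_mul Finset.univ
    (r := fun p : X × X => Q p.1 p.2 * ((φ p.1 - φ p.2) * (h p.1 - h p.2)))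
    (f := fun p => Q p.1 p.2 * ((h p.1 - h p.2) * (h p.1 - h p.2)))
    (g := fun p => Q p.1 p.2 * (φ p.1 - φ p.2) ^ 2)
    (fun p _ => mul_nonneg (h0 _ _) (mul_self_nonneg _))
    (fun p _ => mul_nonneg (h0 _ _) (sq_nonneg _)) (fun p _ => le_of_eq (by ring))
  rw [e3, e4, e5]
  linarith

end Energy

namespace ReversibleChain

/-! ### Solving the Poisson equation -/

section Poisson

variable {X : Type*} [Fintype X] [DecidableEq X] (C : ReversibleChain X)

theorem pow_stochastic (hs : ∀ x y, C.P x y = C.P y x) (t : ℕ) :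
    (∀ x y, 0 ≤ (C.P ^ t) x y) ∧ (∀ x y, (C.P ^ t) x y = (C.P ^ t) y x) ∧
      ∀ x, ∑ y, (C.P ^ t) x y = 1 := by
  refine ⟨?_, ?_, ?_⟩
  · induction t with
    | zero => intro x y; rw [pow_zero, Matrix.one_apply]; positivity
    | succ t ih =>
      intro x y
      rw [pow_succ, Matrix.mul_apply]
      exact Finset.sum_nonneg fun z _ => mul_nonneg (ih x z) (C.P_nonneg z y)
  · have hP : C.P.IsSymm := Matrix.IsSymm.ext fun x y => hs y x
    intro x y
    exact (hP.pow t).apply y x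
  · induction t with
    | zero => intro x; simp [Matrix.one_apply]
    | succ t ih =>
      intro x
      simp only [pow_succ, Matrix.mul_apply]
      rw [Finset.sum_comm]
      simp only [← Finset.mul_sum, C.P_sum, mul_one, ih]

/-- Harmonic functions of a symmetric chain are constant. -/
theorem eq_of_harmonic (hs : ∀ x y, C.P x y = C.P y x) {h : X → ℝ}
    (hh : ∀ x, h x - ∑ y, C.P x y * h y = 0) (x y : X) : h x = h y := by
  obtain ⟨t, ht⟩ := C.ergodic
  obtain ⟨p0, ps, p1⟩ := C.pow_stochastic hs t
  have h1 : C.P.mulVec h = h := by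
    ext x
    have := hh x
    simp only [Matrix.mulVec, dotProduct]
    linarith
  have h2 : ∀ k : ℕ, (C.P ^ k).mulVec h = h := by
    intro k
    induction k with
    | zero => simp
    | succ k ih => rw [pow_succ, ← Matrix.mulVec_mulVec, h1, ih]
  have h3 : ∀ x, h x - ∑ y, (C.P ^ t) x y * h y = 0 := by
    intro x
    have := congrFun (h2 t) x
    simp only [Matrix.mulVec, dotProduct] at this
    linarith
  -- By ergodicity some power of `P` has no zero entry, so zero energy for that power equates the
  -- values at all pairs at once, with no argument along paths.
  have e := sum_energy ps p1 h h
  simp only [h3, mul_zero, Finset.sum_const_zero] at e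
  have nn : ∀ x y, 0 ≤ (C.P ^ t) x y * ((h x - h y) * (h x - h y)) := fun x y =>
    mul_nonneg (p0 x y) (mul_self_nonneg _)
  have e1 := (Finset.sum_eq_zero_iff_of_nonneg
    (fun x _ => Finset.sum_nonneg fun y _ => nn x y)).1 e x (Finset.mem_univ x)
  have e2 := (Finset.sum_eq_zero_iff_of_nonneg (fun y _ => nn x y)).1 e1 y (Finset.mem_univ y)
  rcases mul_eq_zero.1 e2 with h' | h'
  · exact absurd h' (ht x y)
  · exact sub_eq_zero.1 (mul_self_eq_zero.1 h')

/-- The Poisson equation `(1 - P) h = b` of a symmetric chain is solvable when `∑ b = 0`. -/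
theorem exists_poisson (hs : ∀ x y, C.P x y = C.P y x) {b : X → ℝ} (hb : ∑ x, b x = 0) :
    ∃ h : X → ℝ, ∀ x, h x - ∑ y, C.P x y * h y = b x := by
  -- Adding the total sum removes the kernel of `1 - P`, the constants. The perturbed map is
  -- injective, hence surjective, and the extra term vanishes when the right-hand side sums to `0`.
  let T : (X → ℝ) →ₗ[ℝ] (X → ℝ) :=
    { toFun := fun h x => h x - ∑ y, C.P x y * h y + ∑ y, h y
      map_add' := fun f g => by
        ext x; simp only [Pi.add_apply, mul_add, Finset.sum_add_distrib]; ring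
      map_smul' := fun c f => by
        ext x
        simp only [Pi.smul_apply, smul_eq_mul, RingHom.id_apply, ← Finset.mul_sum,
          mul_left_comm _ c]
        ring }
  have hT : ∀ h x, T h x = h x - ∑ y, C.P x y * h y + ∑ y, h y := fun _ _ => rfl
  have hsum0 : ∀ h : X → ℝ, ∑ x, (h x - ∑ y, C.P x y * h y) = 0 := by
    intro h
    have := sum_energy hs C.P_sum (fun _ => 1) h
    simp only [sub_self, zero_mul, mul_zero, Finset.sum_const_zero, one_mul] at this
    linarith
  have hsum : ∀ h : X → ℝ, ∑ x, T h x = 0 → ∑ y, h y = 0 := by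
    intro h h0
    simp only [hT] at h0
    rw [Finset.sum_add_distrib, hsum0, zero_add, Finset.sum_const, nsmul_eq_mul] at h0
    rcases mul_eq_zero.1 h0 with h' | h'
    · have : IsEmpty X := by
        rw [← Fintype.card_eq_zero_iff]; exact_mod_cast h'
      simp
    · exact h'
  have inj : Function.Injective T := by
    refine (injective_iff_map_eq_zero T).2 fun h h0 => ?_
    have hz := hsum h (by simp [h0])
    have hh : ∀ x, h x - ∑ y, C.P x y * h y = 0 := by
      intro x
      have := congrFun h0 x
      rw [hT, hz, add_zero] at this
      exact this
    ext x
    have hc : ∑ y, h y = ∑ _y : X, h x :=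
      Finset.sum_congr rfl fun y _ => C.eq_of_harmonic hs hh y x
    rw [hz, Finset.sum_const, nsmul_eq_mul] at hc
    rcases mul_eq_zero.1 hc.symm with h' | h'
    · have : IsEmpty X := by
        rw [← Fintype.card_eq_zero_iff]; exact_mod_cast h'
      exact (IsEmpty.false x).elim
    · exact h'
  obtain ⟨h, hh⟩ := LinearMap.injective_iff_surjective.1 inj b
  have hz := hsum h (by rw [hh]; exact hb)
  refine ⟨h, fun x => ?_⟩
  have := congrFun hh x
  rwa [hT, hz, add_zero] at this

end Poisson

/-! ### The spectral sum in closed form -/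

section Spectral

variable {X : Type*} [Fintype X] [DecidableEq X]

/-- The quadratic form of the pseudo-inverse of `1 - D`, in terms of a solution of
`(1 - D) g = f` modulo the kernel of `1 - D`. -/
theorem sum_eigenbasis_inv {D : Matrix X X ℝ} (hD : D.IsHermitian) (f g : X → ℝ)
    (hf : D.mulVec (f - (g - D.mulVec g)) = f - (g - D.mulVec g)) :
    ∑ k with hD.eigenvalues k ≠ 1,
      (inner ℝ (hD.eigenvectorBasis k) (WithLp.toLp 2 f)) ^ 2 / (1 - hD.eigenvalues k) =
    ∑ x, g x * (g x - D.mulVec g x) := by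
  have hinner : ∀ k (u : X → ℝ), inner ℝ (hD.eigenvectorBasis k) (WithLp.toLp 2 u) =
      (hD.eigenvectorBasis k : X → ℝ) ⬝ᵥ u := by
    intro k u
    rw [EuclideanSpace.inner_eq_star_dotProduct]
    simp [dotProduct_comm]
  have hDt : ∀ u w : X → ℝ, u ⬝ᵥ D.mulVec w = D.mulVec u ⬝ᵥ w := by
    intro u w
    have : D.transpose = D := by
      rw [← Matrix.conjTranspose_eq_transpose_of_trivial]; exact hD
    rw [Matrix.dotProduct_mulVec, ← Matrix.mulVec_transpose, this]
  have hshift : ∀ k (u : X → ℝ), (hD.eigenvectorBasis k : X → ℝ) ⬝ᵥ D.mulVec u =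
      hD.eigenvalues k * ((hD.eigenvectorBasis k : X → ℝ) ⬝ᵥ u) := by
    intro k u
    rw [hDt, hD.mulVec_eigenvectorBasis, smul_dotProduct, smul_eq_mul]
  -- The residual `f - (1 - D) g` is fixed by `D`, hence orthogonal to every eigenvector with
  -- eigenvalue other than `1`.
  have hterm : ∀ k, hD.eigenvalues k ≠ 1 → (hD.eigenvectorBasis k : X → ℝ) ⬝ᵥ f =
      (1 - hD.eigenvalues k) * ((hD.eigenvectorBasis k : X → ℝ) ⬝ᵥ g) := by
    intro k hk
    have e := hshift k (f - (g - D.mulVec g))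
    rw [hf, dotProduct_sub, dotProduct_sub, hshift] at e
    have hk' : (1 - hD.eigenvalues k) ≠ 0 := sub_ne_zero.2 hk.symm
    apply mul_left_cancel₀ hk'
    linarith
  have hr : ∑ x, g x * (g x - D.mulVec g x) =
      inner ℝ (WithLp.toLp 2 g : EuclideanSpace ℝ X) (WithLp.toLp 2 (g - D.mulVec g)) := by
    rw [EuclideanSpace.inner_eq_star_dotProduct]
    simp [dotProduct, mul_comm]
  rw [hr, ← OrthonormalBasis.sum_inner_mul_inner hD.eigenvectorBasis, Finset.sum_filter]
  refine Finset.sum_congr rfl fun k _ => ?_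
  rw [real_inner_comm (hD.eigenvectorBasis k) (WithLp.toLp 2 g), hinner, hinner, hinner, dotProduct_sub, hshift]
  split_ifs with hk
  · have hk' : (1 - hD.eigenvalues k) ≠ 0 := sub_ne_zero.2 (Ne.symm hk)
    rw [hterm k hk]
    field_simp
  · rw [not_not.1 hk]; ring

variable (C : ReversibleChain X) (M : Finset X)

/-- Gives `D(s) = S P S + s 1_M` with `S` equal to `√(1 - s)` on `M` and `1` elsewhere. Between a
marked and an unmarked state only one of the two transitions is slowed by `1 - s`, and the geometric
mean turns this into a square root. -/
theorem discriminant_apply (hs : ∀ x y, C.P x y = C.P y x) {s : ℝ} (h0 : 0 ≤ s) (h1 : s ≤ 1)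
    (x y : X) : C.discriminant M s x y =
      (if x ∈ M then √(1 - s) else 1) * C.P x y * (if y ∈ M then √(1 - s) else 1) +
        if x = y ∧ x ∈ M then s else 0 := by
  have hε : 0 ≤ 1 - s := sub_nonneg.2 h1
  have hsq : √(1 - s) * √(1 - s) = 1 - s := Real.mul_self_sqrt hε
  have hP := C.P_nonneg x y
  have hint : ∀ x y, C.interpolated M s x y =
      if x ∈ M then (1 - s) * C.P x y + (if x = y then s else 0) else C.P x y := by
    intro x y
    simp only [interpolated, absorbing, Matrix.add_apply, Matrix.smul_apply, Matrix.of_apply,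
      smul_eq_mul]
    split_ifs <;> ring
  simp only [discriminant, Matrix.of_apply, hint, hs y x]
  by_cases hxy : x = y
  · subst hxy
    by_cases hx : x ∈ M
    · simp only [hx, if_true, true_and]
      rw [Real.sqrt_mul_self (by positivity)]
      linear_combination (-C.P x x) * hsq
    · simp only [hx, if_false, and_false]
      rw [Real.sqrt_mul_self hP]; ring
  · have hyx : ¬ y = x := fun h => hxy h.symm
    by_cases hx : x ∈ M <;> by_cases hy : y ∈ M <;>
      simp only [hx, hy, hxy, hyx, if_true, if_false, false_and, add_zero, one_mul, mul_one]
    · rw [Real.sqrt_mul_self (by positivity)]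
      linear_combination (-C.P x y) * hsq
    · rw [mul_assoc, Real.sqrt_mul hε, Real.sqrt_mul_self hP]
    · rw [mul_left_comm, Real.sqrt_mul hε, Real.sqrt_mul_self hP, mul_comm]
    · rw [Real.sqrt_mul_self hP]

/-- Closed form of `HT(s)` for a symmetric chain, in terms of the potential `h` of the
signed measure `|M| - |X| 1_M`. -/
theorem interpolatedHT_eq (hs : ∀ x y, C.P x y = C.P y x) {p : ℝ} (hp : ∀ x, C.π x = p)
    (hM : M.Nonempty) {h : X → ℝ}
    (hh : ∀ x, h x - ∑ y, C.P x y * h y = M.card - if x ∈ M then (Fintype.card X : ℝ) else 0)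
    {s : ℝ} (h0 : 0 ≤ s) (h1 : s < 1) :
    C.interpolatedHT M s = 1 / (1 - C.markedProb M) *
      (p / ((1 - s) * (Fintype.card X - M.card) + M.card) ^ 2 *
        ∑ x, ((M.card : ℝ) - if x ∈ M then (Fintype.card X : ℝ) else 0) * h x) := by
  have hε : 0 < 1 - s := sub_pos.2 h1
  set r := √(1 - s) with hr
  have hr0 : 0 < r := Real.sqrt_pos.2 hε
  have hrr : r * r = 1 - s := Real.mul_self_sqrt hε.le
  have hm : (0 : ℝ) < M.card := by exact_mod_cast hM.card_pos
  have hn : (M.card : ℝ) ≤ Fintype.card X := by exact_mod_cast M.card_le_univ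
  set n : ℝ := (Fintype.card X : ℝ)
  set m : ℝ := (M.card : ℝ)
  set q := (1 - s) * (n - m) + m with hq
  have hq0 : 0 < q := by
    have := mul_nonneg hε.le (sub_nonneg.2 hn)
    linarith
  have hp0 : 0 ≤ p := by
    obtain ⟨x, _⟩ := hM
    rw [← hp x]; exact C.π_nonneg x
  -- With this `c`, the residual of `√π_U` after subtracting `(1 - D) g`, where `g = c S⁻¹ h`,
  -- becomes a multiple of `S⁻¹ 1`, which spans the image under `S⁻¹` of the constants and is fixed
  -- by `D(s)`. Matching the residual on `M` and off `M` forces `q = (1 - s)(n - m) + m`.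
  set c := √p / q with hc
  set S : X → ℝ := fun x => if x ∈ M then r else 1 with hS
  have hS0 : ∀ x, S x ≠ 0 := fun x => by simp only [hS]; split_ifs <;> positivity
  have hDv : ∀ (u : X → ℝ) x, (C.discriminant M s).mulVec (fun y => u y / S y) x =
      S x * ∑ y, C.P x y * u y + (if x ∈ M then s * (u x / S x) else 0) := by
    intro u x
    have e : ∀ y, C.discriminant M s x y * (u y / S y) =
        S x * (C.P x y * u y) + if x = y then (if x ∈ M then s * (u x / S x) else 0) else 0 := by
      intro y
      have hy := hS0 y
      rw [discriminant_apply C M hs h0 h1.le, add_mul]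
      congr 1
      · change S x * C.P x y * S y * (u y / S y) = _
        field_simp
      · by_cases hxy : x = y
        · subst hxy
          by_cases hx : x ∈ M <;> simp [hx]
        · simp [hxy]
    simp only [Matrix.mulVec, dotProduct, e, Finset.sum_add_distrib, Finset.sum_ite_eq,
      Finset.mem_univ, if_true, Finset.mul_sum]
  -- `1 - D` is `S (1 - P) S`
  have hA : ∀ (u : X → ℝ) x, u x / S x - (C.discriminant M s).mulVec (fun y => u y / S y) x =
      S x * (u x - ∑ y, C.P x y * u y) := by
    intro u x
    rw [hDv]
    simp only [hS]
    split_ifs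
    · field_simp
      linear_combination (-(u x)) * hrr
    · ring
  set g : X → ℝ := fun x => c * h x / S x with hg
  have hgA : ∀ x, g x - (C.discriminant M s).mulVec g x =
      c * (S x * (m - if x ∈ M then n else 0)) := by
    intro x
    rw [hg]
    rw [hA (fun x => c * h x) x, ← hh x]
    simp only [mul_left_comm _ c, ← Finset.mul_sum]
    ring
  have hf : ∀ x, (if x ∈ M then 0 else √p) - (g x - (C.discriminant M s).mulVec g x) =
      (c * ((1 - s) * (n - m))) / S x := by
    intro x
    rw [hgA, hc]
    simp only [hS]
    split_ifs
    · field_simp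
      linear_combination √p * (n - m) * hrr
    · field_simp
      rw [hq]; ring
  have hfix : (C.discriminant M s).mulVec
      ((fun x => if x ∈ M then 0 else √p) - (g - (C.discriminant M s).mulVec g)) =
      (fun x => if x ∈ M then 0 else √p) - (g - (C.discriminant M s).mulVec g) := by
    have e : ((fun x => if x ∈ M then 0 else √p) - (g - (C.discriminant M s).mulVec g)) =
        fun x => (c * ((1 - s) * (n - m))) / S x := funext hf
    rw [e]
    ext x
    have := hA (fun _ => c * ((1 - s) * (n - m))) x
    simp only [← Finset.sum_mul, C.P_sum, one_mul, sub_self, mul_zero] at this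
    linarith
  have key := sum_eigenbasis_inv (C.discriminant_isHermitian M s) _ g hfix
  unfold interpolatedHT
  congr 1
  have hu : C.sqrtUnmarked M = WithLp.toLp 2 (fun x => if x ∈ M then 0 else √p) := by
    simp only [sqrtUnmarked, hp]
  rw [hu, key, Finset.mul_sum]
  refine Finset.sum_congr rfl fun x _ => ?_
  rw [hgA]
  have := hS0 x
  have hpp : √p * √p = p := Real.mul_self_sqrt hp0
  simp only [hg, hc]
  field_simp
  rw [sq, hpp]
  ring

end Spectral

section Limit

variable {X : Type*} [Fintype X] [DecidableEq X] (C : ReversibleChain X) (M : Finset X)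

/-- The limit defining `HT⁺` exists for a symmetric chain, with an explicit value. -/
theorem tendsto_interpolatedHT (hs : ∀ x y, C.P x y = C.P y x) {p : ℝ} (hp : ∀ x, C.π x = p)
    (hM : M.Nonempty) {h : X → ℝ}
    (hh : ∀ x, h x - ∑ y, C.P x y * h y = M.card - if x ∈ M then (Fintype.card X : ℝ) else 0) :
    Tendsto (C.interpolatedHT M) (𝓝[<] 1) (𝓝 (1 / (1 - C.markedProb M) *
      (p / (M.card : ℝ) ^ 2 *
        ∑ x, ((M.card : ℝ) - if x ∈ M then (Fintype.card X : ℝ) else 0) * h x))) := by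
  have hm : (0 : ℝ) < M.card := by exact_mod_cast hM.card_pos
  have h1 : Tendsto (fun s : ℝ => 1 / (1 - C.markedProb M) *
      (p / ((1 - s) * (Fintype.card X - M.card) + M.card) ^ 2 *
        ∑ x, ((M.card : ℝ) - if x ∈ M then (Fintype.card X : ℝ) else 0) * h x)) (𝓝[<] 1)
      (𝓝 (1 / (1 - C.markedProb M) *
      (p / ((1 - 1) * (Fintype.card X - M.card) + M.card) ^ 2 *
        ∑ x, ((M.card : ℝ) - if x ∈ M then (Fintype.card X : ℝ) else 0) * h x))) := by
    refine Tendsto.mono_left ?_ nhdsWithin_le_nhds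
    refine ContinuousAt.tendsto (x := (1 : ℝ)) (f := fun s : ℝ => 1 / (1 - C.markedProb M) *
      (p / ((1 - s) * (Fintype.card X - M.card) + M.card) ^ 2 *
        ∑ x, ((M.card : ℝ) - if x ∈ M then (Fintype.card X : ℝ) else 0) * h x)) ?_
    refine ContinuousAt.mul continuousAt_const (ContinuousAt.mul ?_ continuousAt_const)
    refine ContinuousAt.div continuousAt_const (by fun_prop) ?_
    simp [hm.ne']
  rw [sub_self, zero_mul, zero_add] at h1
  refine h1.congr' ?_
  have hev : ∀ᶠ s : ℝ in 𝓝[<] 1, s ∈ Set.Ico (0 : ℝ) 1 := Ico_mem_nhdsLT one_pos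
  filter_upwards [hev] with s hs'
  exact (C.interpolatedHT_eq M hs hp hM hh hs'.1 hs'.2).symm

end Limit

end ReversibleChain
end SpatialSearch

namespace SpatialSearch

/-! ### The test function: cyclic distance on the torus -/

section TorusGeometry

theorem sum_torusMatrix_mul (N : ℕ) [NeZero N] (x : Vertex N) (f : Vertex N → ℝ) :
    ∑ y, torusMatrix N x y * f y =
      (f x + f (x + (1, 0)) + f (x - (1, 0)) + f (x + (0, 1)) + f (x - (0, 1))) / 5 := by
  simp only [torusMatrix, Matrix.of_apply, div_mul_eq_mul_div]
  rw [← Finset.sum_div]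
  simp only [add_mul, Finset.sum_add_distrib, ite_mul, one_mul, zero_mul, Finset.sum_ite_eq',
    Finset.mem_univ, if_true]

/-- The distance of a residue to `0` on the cycle `ZMod N`. -/
noncomputable def cycleDist {N : ℕ} (z : ZMod N) : ℝ := (z.valMinAbs.natAbs : ℝ)

variable {N : ℕ} [NeZero N]

omit [NeZero N] in
theorem cycleDist_nonneg (z : ZMod N) : 0 ≤ cycleDist z := Nat.cast_nonneg _

omit [NeZero N] in
theorem cycleDist_add_le (a b : ZMod N) : cycleDist (a + b) ≤ cycleDist a + cycleDist b := by
  unfold cycleDist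
  exact_mod_cast (ZMod.natAbs_valMinAbs_add_le a b).trans (Int.natAbs_add_le _ _)

omit [NeZero N] in
theorem cycleDist_neg (a : ZMod N) : cycleDist (-a) = cycleDist a := by
  unfold cycleDist
  rw [ZMod.natAbs_valMinAbs_neg]

theorem cycleDist_natCast_le (a : ℕ) : cycleDist (a : ZMod N) ≤ a := by
  unfold cycleDist
  rw [ZMod.valMinAbs_natAbs_eq_min, ZMod.val_natCast]
  exact_mod_cast (min_le_left _ _).trans (Nat.mod_le a N)

theorem cycleDist_le (z : ZMod N) : cycleDist z ≤ N := by
  unfold cycleDist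
  exact_mod_cast (ZMod.natAbs_valMinAbs_le z).trans (Nat.div_le_self _ _)

theorem sq_cycleDist_sub_add_one_le (z : ZMod N) :
    (cycleDist z - cycleDist (z + 1)) ^ 2 ≤ 1 := by
  have h1 : cycleDist (1 : ZMod N) ≤ 1 := by simpa using cycleDist_natCast_le (N := N) 1
  have h2 := cycleDist_add_le z 1
  have h3 := cycleDist_add_le (z + 1) (-1)
  rw [cycleDist_neg, add_neg_cancel_right] at h3
  rw [sq_le_one_iff_abs_le_one, abs_le]
  constructor <;> linarith

theorem sq_cycleDist_sub_sub_one_le (z : ZMod N) :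
    (cycleDist z - cycleDist (z - 1)) ^ 2 ≤ 1 := by
  have := sq_cycleDist_sub_add_one_le (z - 1)
  rw [sub_add_cancel] at this
  rwa [← neg_sub, neg_sq]

/-- The cyclic distance changes by at most `1` along an edge, so each vertex contributes at most
`1`. -/
theorem energy_cycleDist_le :
    ∑ x : Vertex N, ∑ y, torusMatrix N x y * (cycleDist x.1 - cycleDist y.1) ^ 2 ≤ (N : ℝ) ^ 2 := by
  have h : ∀ x : Vertex N, ∑ y, torusMatrix N x y * (cycleDist x.1 - cycleDist y.1) ^ 2 ≤ 1 := by
    intro x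
    rw [sum_torusMatrix_mul N x fun y => (cycleDist x.1 - cycleDist y.1) ^ 2]
    have h1 := sq_cycleDist_sub_add_one_le x.1
    have h2 := sq_cycleDist_sub_sub_one_le x.1
    simp only [Prod.fst_add, Prod.fst_sub, add_zero, sub_zero, sub_self]
    linarith
  refine (Finset.sum_le_sum fun x _ => h x).trans (le_of_eq ?_)
  simp [Fintype.card_prod, ZMod.card, sq]

/-- Pair `z` with `c - z` for the antipode `c = ⌊N/2⌋`: by the triangle inequality the two distances
add up to at least `⌊N/2⌋ ≥ N / 4`. -/
theorem le_sum_cycleDist (hN : 2 ≤ N) : (N : ℝ) ^ 2 / 8 ≤ ∑ z : ZMod N, cycleDist z := by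
  set c : ZMod N := ((N / 2 : ℕ) : ZMod N) with hc
  have h1 : ∑ z : ZMod N, cycleDist (c - z) = ∑ z : ZMod N, cycleDist z :=
    (Equiv.subLeft c).sum_comp cycleDist
  have h2 : cycleDist c = ((N / 2 : ℕ) : ℝ) := by
    unfold cycleDist
    rw [hc, ZMod.valMinAbs_natCast_of_le_half le_rfl, Int.natAbs_natCast]
  have h3 : ∑ _z : ZMod N, cycleDist c ≤ ∑ z : ZMod N, (cycleDist z + cycleDist (c - z)) := by
    refine Finset.sum_le_sum fun z _ => ?_
    have := cycleDist_add_le z (c - z)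
    rwa [add_sub_cancel] at this
  rw [Finset.sum_add_distrib, h1, Finset.sum_const, Finset.card_univ, ZMod.card, nsmul_eq_mul,
    h2] at h3
  have h4 : (N : ℝ) ≤ 4 * ((N / 2 : ℕ) : ℝ) := by
    have : N ≤ 4 * (N / 2) := by omega
    exact_mod_cast this
  have h5 : (0 : ℝ) ≤ N := Nat.cast_nonneg _
  nlinarith

end TorusGeometry

/-! ### Counting marked vertices and their distances -/

section Subgrid

variable (N : ℕ) [NeZero N]

omit [NeZero N] in
theorem card_subgrid_le (k e : ℕ) : (subgrid N k e).card ≤ k ^ 2 := by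
  refine Finset.card_image_le.trans (le_of_eq ?_)
  simp [sq]

omit [NeZero N] in
-- Under `k * e ≤ N` the multiples of `e` do not wrap around the cycle, so they are distinct
-- residues.
theorem card_subgrid {k e : ℕ} (he : 0 < e) (h : k * e ≤ N) : (subgrid N k e).card = k ^ 2 := by
  unfold subgrid
  rw [Finset.card_image_of_injOn]
  · simp [sq]
  · have inj : ∀ a < k, ∀ b < k, ((a * e : ℕ) : ZMod N) = ((b * e : ℕ) : ZMod N) → a = b := by
      intro a ha b hb hab
      have lt : ∀ a < k, a * e < N := fun a ha =>
        lt_of_lt_of_le (Nat.mul_lt_mul_of_pos_right ha he) h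
      rw [ZMod.natCast_eq_natCast_iff'] at hab
      rw [Nat.mod_eq_of_lt (lt a ha), Nat.mod_eq_of_lt (lt b hb)] at hab
      exact Nat.eq_of_mul_eq_mul_right he hab
    intro a ha b hb hab
    simp only [Finset.coe_product, Finset.coe_range, Set.mem_prod, Set.mem_Iio] at ha hb
    rw [Prod.mk.injEq] at hab
    exact Prod.ext (inj _ ha.1 _ hb.1 hab.1) (inj _ ha.2 _ hb.2 hab.2)

theorem cycleDist_fst_le_of_mem_subgrid {k e : ℕ} {x : Vertex N} (hx : x ∈ subgrid N k e) :
    cycleDist x.1 ≤ k * e := by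
  simp only [subgrid, Finset.mem_image, Finset.mem_product, Finset.mem_range] at hx
  obtain ⟨j, hj, rfl⟩ := hx
  refine (cycleDist_natCast_le _).trans ?_
  exact_mod_cast Nat.mul_le_mul_right e hj.1.le

/-- The sparse grid contains the fibre over `0` of reduction mod `d`; this links its hitting time to
the `d × d` torus. -/
theorem mem_subgrid_of_castHom_eq_zero {d : ℕ} (hd : d ∣ N) {x : Vertex N}
    (h1 : ZMod.castHom hd (ZMod d) x.1 = 0) (h2 : ZMod.castHom hd (ZMod d) x.2 = 0) :
    x ∈ subgrid N (N / d) d := by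
  have key : ∀ z : ZMod N, ZMod.castHom hd (ZMod d) z = 0 →
      ∃ j < N / d, ((j * d : ℕ) : ZMod N) = z := by
    intro z hz
    rw [← ZMod.natCast_zmod_val z, map_natCast, ZMod.natCast_eq_zero_iff] at hz
    refine ⟨z.val / d, Nat.div_lt_div_of_lt_of_dvd hd (ZMod.val_lt z), ?_⟩
    rw [Nat.div_mul_cancel hz, ZMod.natCast_zmod_val]
  obtain ⟨j1, hj1, e1⟩ := key x.1 h1
  obtain ⟨j2, hj2, e2⟩ := key x.2 h2
  simp only [subgrid, Finset.mem_image, Finset.mem_product, Finset.mem_range]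
  exact ⟨(j1, j2), ⟨hj1, hj2⟩, Prod.ext e1 e2⟩

variable {N}
variable {d₁ k₁ d : ℕ}

omit [NeZero N] in
theorem sq_le_card_markedSet (hd₁ : 0 < d₁) (h : k₁ * d₁ ≤ N) :
    k₁ ^ 2 ≤ (markedSet N d₁ k₁ d).card := by
  rw [← card_subgrid N hd₁ h]
  exact Finset.card_le_card Finset.subset_union_left

/-- Ensures an unmarked vertex: `p_M < 1` in the prefactor of `HT⁺`, and `HT > 0`. -/
theorem card_markedSet_lt (hd₁ : 0 < d₁) (hdense : 32 * (k₁ * d₁) ≤ N)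
    (hsparse : 8 * (N / d) ≤ k₁) : (markedSet N d₁ k₁ d).card < N ^ 2 := by
  have hN : 0 < N := Nat.pos_of_ne_zero (NeZero.ne N)
  have h1 : k₁ ≤ k₁ * d₁ := Nat.le_mul_of_pos_right _ hd₁
  have h2 := (Finset.card_union_le _ _).trans
    (add_le_add (card_subgrid_le N k₁ d₁) (card_subgrid_le N (N / d) d))
  change (markedSet N d₁ k₁ d).card ≤ _ at h2
  have h3 : (4 * k₁) ^ 2 ≤ N ^ 2 := Nat.pow_le_pow_left (by omega) 2
  have h4 : (4 * (N / d)) ^ 2 ≤ N ^ 2 := Nat.pow_le_pow_left (by omega) 2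
  have h5 : 0 < N ^ 2 := by positivity
  rw [mul_pow] at h3 h4
  omega

/-- The sum of the distances of the marked vertices is small, as most of them lie in the dense
subgrid. -/
theorem sum_markedSet_cycleDist_le (hd₁ : 0 < d₁) (hdense : 32 * (k₁ * d₁) ≤ N)
    (hsparse : 8 * (N / d) ≤ k₁) :
    ∑ x ∈ markedSet N d₁ k₁ d, cycleDist x.1 ≤ (markedSet N d₁ k₁ d).card * (N / 16 : ℝ) := by
  have hcard : ((k₁ : ℝ)) ^ 2 ≤ (markedSet N d₁ k₁ d).card := by
    exact_mod_cast sq_le_card_markedSet (d := d) hd₁ (by omega)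
  have h1 : ∑ x ∈ subgrid N k₁ d₁, cycleDist x.1 ≤ (k₁ : ℝ) ^ 2 * (N / 32) := by
    refine (Finset.sum_le_card_nsmul _ _ (N / 32 : ℝ) fun x hx => ?_).trans ?_
    · refine (cycleDist_fst_le_of_mem_subgrid N hx).trans ?_
      have : (32 : ℝ) * (k₁ * d₁) ≤ N := by exact_mod_cast hdense
      linarith
    · rw [nsmul_eq_mul]
      gcongr
      exact_mod_cast card_subgrid_le N k₁ d₁
  -- Sparse vertices may be far away, but there are at most `k₁² / 64` of them. Together with the
  -- dense grid this totals `(1/32 + 1/64) k₁² N`, below `|M| N / 16`.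
  have h2 : ∑ x ∈ subgrid N (N / d) d, cycleDist x.1 ≤ (k₁ : ℝ) ^ 2 / 64 * N := by
    refine (Finset.sum_le_card_nsmul _ _ (N : ℝ) fun x _ => cycleDist_le x.1).trans ?_
    rw [nsmul_eq_mul]
    gcongr
    have ha : ((subgrid N (N / d) d).card : ℝ) ≤ ((N / d : ℕ) : ℝ) ^ 2 := by
      exact_mod_cast card_subgrid_le N (N / d) d
    have hb : (8 : ℝ) * ((N / d : ℕ) : ℝ) ≤ k₁ := by exact_mod_cast hsparse
    have hc : (0 : ℝ) ≤ ((N / d : ℕ) : ℝ) := Nat.cast_nonneg _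
    nlinarith
  have h3 : ∑ x ∈ markedSet N d₁ k₁ d, cycleDist x.1 ≤
      ∑ x ∈ subgrid N k₁ d₁, cycleDist x.1 + ∑ x ∈ subgrid N (N / d) d, cycleDist x.1 := by
    have := Finset.sum_union_inter (s₁ := subgrid N k₁ d₁) (s₂ := subgrid N (N / d) d)
      (f := fun x : Vertex N => cycleDist x.1)
    have h0 : 0 ≤ ∑ x ∈ subgrid N k₁ d₁ ∩ subgrid N (N / d) d, cycleDist x.1 :=
      Finset.sum_nonneg fun x _ => cycleDist_nonneg _
    unfold markedSet
    linarith
  have hN : (0 : ℝ) ≤ N := Nat.cast_nonneg _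
  nlinarith

end Subgrid

/-! ### Lower bound on the extended hitting time -/

section ExtendedHT

variable {d₁ k₁ d N : ℕ+}

theorem extendedHT_lower_bound (hdense : 32 * ((k₁ : ℕ) * (d₁ : ℕ)) ≤ (N : ℕ))
    (hsparse : 8 * ((N : ℕ) / (d : ℕ)) ≤ (k₁ : ℕ)) :
    Tendsto (gridInterpolatedHT d₁ k₁ d N) (𝓝[<] 1) (𝓝 (gridExtendedHT d₁ k₁ d N)) ∧
      1 / 128 * ((N : ℕ) : ℝ) ^ 2 ≤ gridExtendedHT d₁ k₁ d N := by
  set M := markedSet (N : ℕ) d₁ k₁ d with hM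
  set C := torusWalk (N : ℕ) with hC
  have hk : 0 < (k₁ : ℕ) := k₁.pos
  have hNpos : (0 : ℝ) < ((N : ℕ) : ℝ) := by exact_mod_cast N.pos
  have hcard : ((k₁ : ℕ)) ^ 2 ≤ M.card := sq_le_card_markedSet d₁.pos (by omega)
  have hm : 0 < M.card := lt_of_lt_of_le (by positivity) hcard
  have hlt : M.card < (N : ℕ) ^ 2 := card_markedSet_lt d₁.pos hdense hsparse
  have hm' : (0 : ℝ) < M.card := by exact_mod_cast hm
  have hlt' : (M.card : ℝ) < ((N : ℕ) : ℝ) ^ 2 := by exact_mod_cast hlt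
  have hs : ∀ x y, C.P x y = C.P y x := torusMatrix_symm (N : ℕ)
  have hp : ∀ x, C.π x = 1 / ((N : ℕ) : ℝ) ^ 2 := fun _ => rfl
  have hX : (Fintype.card (Vertex (N : ℕ)) : ℝ) = ((N : ℕ) : ℝ) ^ 2 := by
    simp [Fintype.card_prod, ZMod.card, sq]
  set b : Vertex (N : ℕ) → ℝ := fun x =>
    (M.card : ℝ) - if x ∈ M then (Fintype.card (Vertex (N : ℕ)) : ℝ) else 0 with hb
  have hbφ : ∀ φ : Vertex (N : ℕ) → ℝ, ∑ x, b x * φ x =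
      M.card * ∑ x, φ x - ((N : ℕ) : ℝ) ^ 2 * ∑ x ∈ M, φ x := by
    intro φ
    simp only [hb, sub_mul, Finset.sum_sub_distrib, ite_mul, zero_mul, Finset.sum_ite_mem,
      Finset.univ_inter, ← Finset.mul_sum, hX]
  have hb0 : ∑ x, b x = 0 := by
    have := hbφ fun _ => 1
    simp only [mul_one, Finset.sum_const, nsmul_eq_mul, Finset.card_univ, hX] at this
    rw [this]; ring
  obtain ⟨h, hh⟩ := C.exists_poisson hs hb0
  have hlim := C.tendsto_interpolatedHT M hs hp (Finset.card_pos.1 hm) hh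
  have hval : gridExtendedHT d₁ k₁ d N = _ := hlim.limUnder_eq
  refine ⟨by rw [hval]; exact hlim, ?_⟩
  rw [hval]
  have hN2 : 2 ≤ (N : ℕ) := by
    have := Nat.mul_pos hk d₁.pos
    omega
  -- The gap between the averages `N / 8` over the torus and `N / 16` over `M`, scaled by `|M| N²`.
  have hφ : (M.card : ℝ) * (((N : ℕ) : ℝ) ^ 3 / 16) ≤ ∑ x, b x * cycleDist x.1 := by
    rw [hbφ]
    have h1 := sum_markedSet_cycleDist_le (d := (d : ℕ)) d₁.pos hdense hsparse
    have h2 : ((N : ℕ) : ℝ) * (((N : ℕ) : ℝ) ^ 2 / 8) ≤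
        ∑ x : Vertex (N : ℕ), cycleDist x.1 := by
      rw [Fintype.sum_prod_type]
      simp only [Finset.sum_const, Finset.card_univ, ZMod.card, nsmul_eq_mul, ← Finset.mul_sum]
      exact mul_le_mul_of_nonneg_left (le_sum_cycleDist hN2) hNpos.le
    have h3 := mul_le_mul_of_nonneg_left h2 hm'.le
    have h4 := mul_le_mul_of_nonneg_left h1 (sq_nonneg ((N : ℕ) : ℝ))
    change _ * ∑ x ∈ M, _ ≤ _ * ((M.card : ℝ) * _) at h4
    linarith
  have hE := sq_sum_le_energy hs C.P_sum C.P_nonneg hh fun x => cycleDist x.1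
  change _ ≤ _ * ((∑ x : Vertex (N : ℕ), ∑ y, torusMatrix (N : ℕ) x y * _) / 2) at hE
  have hbh : 0 ≤ ∑ x, b x * h x := by
    have e := sum_energy hs C.P_sum h h
    have h2 : 0 ≤ ∑ x, ∑ y, C.P x y * ((h x - h y) * (h x - h y)) :=
      Finset.sum_nonneg fun x _ => Finset.sum_nonneg fun y _ =>
        mul_nonneg (C.P_nonneg x y) (mul_self_nonneg _)
    simp only [hh, mul_comm (h _)] at e
    change _ = 2 * ∑ x, b x * h x at e
    linarith
  change _ ≤ (∑ x, b x * h x) * _ at hE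
  change (∑ x, b x * _) ^ 2 ≤ _ at hE
  have hE2 : (∑ x, b x * cycleDist x.1) ^ 2 ≤ (∑ x, b x * h x) * (((N : ℕ) : ℝ) ^ 2 / 2) :=
    hE.trans (mul_le_mul_of_nonneg_left
      (by have := energy_cycleDist_le (N := (N : ℕ)); linarith) hbh)
  have hsq : ((M.card : ℝ) * (((N : ℕ) : ℝ) ^ 3 / 16)) ^ 2 ≤
      (∑ x, b x * cycleDist x.1) ^ 2 := pow_le_pow_left₀ (by positivity) hφ 2
  have hpM : C.markedProb M = M.card / ((N : ℕ) : ℝ) ^ 2 := by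
    simp only [ReversibleChain.markedProb, hp, Finset.sum_const, nsmul_eq_mul]
    ring
  have hfac : 1 ≤ 1 / (1 - C.markedProb M) := by
    have h1 : 0 < C.markedProb M := by rw [hpM]; positivity
    have h2 : C.markedProb M < 1 := by
      rw [hpM, div_lt_one (by positivity)]; exact hlt'
    rw [le_div_iff₀ (by linarith)]
    linarith
  -- The constant is `(1/16)²` divided by the energy factor `1/2`; the powers of `|M|` cancel.
  have hmain : 1 / 128 * ((N : ℕ) : ℝ) ^ 2 ≤
      1 / ((N : ℕ) : ℝ) ^ 2 / (M.card : ℝ) ^ 2 * ∑ x, b x * h x := by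
    have e : 1 / ((N : ℕ) : ℝ) ^ 2 / (M.card : ℝ) ^ 2 * ∑ x, b x * h x =
        (∑ x, b x * h x) / (((N : ℕ) : ℝ) ^ 2 * (M.card : ℝ) ^ 2) := by ring
    rw [e, le_div_iff₀ (by positivity)]
    have h5 := hsq.trans hE2
    have h6 : (0 : ℝ) < ((N : ℕ) : ℝ) ^ 2 / 2 := by positivity
    refine le_of_mul_le_mul_right ?_ h6
    refine le_trans (le_of_eq ?_) h5
    ring
  refine hmain.trans ?_
  refine le_mul_of_one_le_left ?_ hfac
  exact mul_nonneg (by positivity) hbh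

end ExtendedHT

end SpatialSearch

namespace SpatialSearch

/-! ### Real characters of the cycle -/

section Characters

variable {d : ℕ} [NeZero d]

/-- The real part of the standard character of `ZMod d`, i.e. `cos (2 π z / d)`. -/
noncomputable def cosChar (z : ZMod d) : ℝ := (ZMod.stdAddChar z).re

theorem cosChar_zero : cosChar (0 : ZMod d) = 1 := by
  simp [cosChar]

theorem cosChar_eq_cos (z : ZMod d) : cosChar z = Real.cos (2 * Real.pi * z.valMinAbs / d) := by
  unfold cosChar
  conv_lhs => rw [← ZMod.coe_valMinAbs z]
  rw [ZMod.stdAddChar_coe]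
  have : (2 * (Real.pi : ℂ) * Complex.I * (z.valMinAbs : ℂ) / (d : ℂ)) =
      ((2 * Real.pi * z.valMinAbs / d : ℝ) : ℂ) * Complex.I := by
    push_cast; ring
  rw [this, Complex.exp_ofReal_mul_I_re]

theorem abs_cosChar_le (z : ZMod d) : |cosChar z| ≤ 1 := by
  rw [cosChar_eq_cos]; exact Real.abs_cos_le_one _

theorem cosChar_add_add_sub (a b : ZMod d) :
    cosChar (a + b) + cosChar (a - b) = 2 * cosChar b * cosChar a := by
  have hb : ZMod.stdAddChar (-b) = (starRingEnd ℂ) (ZMod.stdAddChar b) := by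
    rw [ZMod.stdAddChar_apply, ZMod.stdAddChar_apply, AddChar.map_neg_eq_inv, Circle.coe_inv_eq_conj]
  unfold cosChar
  rw [sub_eq_add_neg, AddChar.map_add_eq_mul, AddChar.map_add_eq_mul, hb]
  simp only [Complex.mul_re, Complex.conj_re, Complex.conj_im]
  ring

theorem sum_cosChar (x : ZMod d × ZMod d) (hx : x ≠ 0) :
    ∑ k : ZMod d × ZMod d, cosChar (k.1 * x.1 + k.2 * x.2) = 0 := by
  have h : ∑ k : ZMod d × ZMod d, (ZMod.stdAddChar (k.1 * x.1 + k.2 * x.2) : ℂ) = 0 := by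
    simp only [AddChar.map_add_eq_mul]
    rw [Fintype.sum_prod_type]
    simp only [← Finset.mul_sum]
    rw [← Finset.sum_mul, AddChar.sum_mulShift _ (ZMod.isPrimitive_stdAddChar d),
      AddChar.sum_mulShift _ (ZMod.isPrimitive_stdAddChar d)]
    by_cases h1 : x.1 = 0
    · have h2 : x.2 ≠ 0 := fun h2 => hx (Prod.ext h1 h2)
      simp [h2]
    · simp [h1]
  have := congrArg Complex.re h
  rw [Complex.re_sum] at this
  simpa [cosChar] using this

/-- The bound `cos x ≤ 1 - 2 x² / π²` needs `|x| ≤ π`, which the representative of least absolute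
value provides. -/
theorem le_one_sub_cosChar (z : ZMod d) : 8 * cycleDist z ^ 2 / (d : ℝ) ^ 2 ≤ 1 - cosChar z := by
  have hd : (0 : ℝ) < d := by exact_mod_cast Nat.pos_of_ne_zero (NeZero.ne d)
  have habs : cycleDist z = |(z.valMinAbs : ℝ)| := by
    unfold cycleDist
    rw [Nat.cast_natAbs, Int.cast_abs]
  have hle : 2 * cycleDist z ≤ d := by
    have : 2 * z.valMinAbs.natAbs ≤ d := by
      have := ZMod.natAbs_valMinAbs_le z
      omega
    unfold cycleDist
    exact_mod_cast this
  have hπ := Real.pi_pos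
  have hx : |2 * Real.pi * z.valMinAbs / d| ≤ Real.pi := by
    rw [abs_div, abs_mul, ← habs, abs_of_pos hd, abs_of_pos (by positivity), div_le_iff₀ hd]
    nlinarith
  have := Real.cos_le_one_sub_mul_cos_sq hx
  rw [← cosChar_eq_cos] at this
  have e : 2 / Real.pi ^ 2 * (2 * Real.pi * z.valMinAbs / d) ^ 2 =
      8 * cycleDist z ^ 2 / (d : ℝ) ^ 2 := by
    rw [habs, sq_abs]
    field_simp
    ring
  linarith

end Characters

/-! ### Logarithmic lattice sums -/

section Counting

variable {d : ℕ} [NeZero d]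

omit [NeZero d] in
theorem cycleDist_pos {z : ZMod d} (hz : z ≠ 0) : 1 ≤ cycleDist z := by
  unfold cycleDist
  have : 0 < z.valMinAbs.natAbs := Int.natAbs_pos.2 fun h => hz ((ZMod.valMinAbs_eq_zero z).1 h)
  exact_mod_cast this

theorem card_cycleDist_le (m : ℕ) :
    (Finset.univ.filter fun z : ZMod d => cycleDist z ≤ m).card ≤ 2 * m + 1 := by
  have hsub : (Finset.univ.filter fun z : ZMod d => cycleDist z ≤ m) ⊆
      (Finset.Icc (-(m : ℤ)) m).image fun j : ℤ => (j : ZMod d) := by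
    intro z hz
    rw [Finset.mem_filter] at hz
    have h1 : z.valMinAbs.natAbs ≤ m := by
      have := hz.2
      unfold cycleDist at this
      exact_mod_cast this
    rw [Finset.mem_image]
    exact ⟨z.valMinAbs, Finset.mem_Icc.2 (by omega), ZMod.coe_valMinAbs z⟩
  refine (Finset.card_le_card hsub).trans (Finset.card_image_le.trans ?_)
  rw [Int.card_Icc]
  omega

theorem sum_inv_cycleDist_le : ∑ z : ZMod d, (cycleDist z)⁻¹ ≤ 2 * (1 + Real.log d) := by
  have h1 : ∑ z : ZMod d, (cycleDist z)⁻¹ =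
      ∑ v ∈ Finset.range d, ((min v (d - v) : ℕ) : ℝ)⁻¹ := by
    refine Finset.sum_nbij' (fun z => z.val) (fun v => (v : ZMod d))
      (fun z _ => Finset.mem_range.2 (ZMod.val_lt z)) (fun _ _ => Finset.mem_univ _)
      (fun z _ => ZMod.natCast_zmod_val z)
      (fun v hv => ZMod.val_cast_of_lt (Finset.mem_range.1 hv)) fun z _ => ?_
    rw [cycleDist, ZMod.valMinAbs_natAbs_eq_min]
  -- The minimum is one of the two entries, so both harmonic sums together dominate. The zero
  -- residue contributes `0⁻¹ = 0` on the left.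
  have h2 : ∀ v ∈ Finset.range d, ((min v (d - v) : ℕ) : ℝ)⁻¹ ≤
      ((v : ℕ) : ℝ)⁻¹ + ((d - v : ℕ) : ℝ)⁻¹ := by
    intro v _
    have a : (0 : ℝ) ≤ ((v : ℕ) : ℝ)⁻¹ := by positivity
    have b : (0 : ℝ) ≤ ((d - v : ℕ) : ℝ)⁻¹ := by positivity
    rcases min_choice v (d - v) with h | h <;> rw [h] <;> linarith
  have hH : ((harmonic d : ℚ) : ℝ) = ∑ i ∈ Finset.range d, ((i + 1 : ℕ) : ℝ)⁻¹ := by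
    simp [harmonic]
  have h3 : ∑ v ∈ Finset.range d, ((v : ℕ) : ℝ)⁻¹ ≤ harmonic d := by
    have e := Finset.sum_range_succ' (fun v : ℕ => ((v : ℕ) : ℝ)⁻¹) d
    rw [Finset.sum_range_succ] at e
    have a : (0 : ℝ) ≤ ((d : ℕ) : ℝ)⁻¹ := by positivity
    rw [hH]
    simp only [Nat.cast_zero, inv_zero, add_zero] at e
    linarith
  have h4 : ∑ v ∈ Finset.range d, ((d - v : ℕ) : ℝ)⁻¹ = harmonic d := by
    rw [hH, ← Finset.sum_range_reflect]
    refine Finset.sum_congr rfl fun v hv => ?_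
    have := Finset.mem_range.1 hv
    congr 2
    omega
  have h5 : ((harmonic d : ℚ) : ℝ) ≤ 1 + Real.log d := harmonic_le_one_add_log d
  rw [h1]
  refine (Finset.sum_le_sum h2).trans ?_
  rw [Finset.sum_add_distrib, h4]
  linarith

/-- The lattice sum `∑ 1 / |k|²` over the nonzero residues grows at most logarithmically. -/
theorem sum_inv_sq_le :
    ∑ k : ZMod d × ZMod d, (cycleDist k.1 ^ 2 + cycleDist k.2 ^ 2)⁻¹ ≤ 12 * (1 + Real.log d) := by
  -- Sort pairs by the larger coordinate `z`: at most `2|z| + 1 ≤ 3|z|` partners `w` for nonzero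
  -- `z`, each of weight at most `|z|⁻²`, which reduces the lattice sum to a harmonic one.
  have half : ∀ z : ZMod d, ∑ w : ZMod d,
      (if cycleDist w ≤ cycleDist z then (cycleDist z ^ 2)⁻¹ else 0) ≤ 3 * (cycleDist z)⁻¹ := by
    intro z
    rw [← Finset.sum_filter, Finset.sum_const, nsmul_eq_mul]
    by_cases hz : z = 0
    · have : cycleDist z = 0 := by simp [cycleDist, hz]
      simp [this]
    · have h1 := cycleDist_pos hz
      have h2 : ((Finset.univ.filter fun w : ZMod d => cycleDist w ≤ cycleDist z).card : ℝ) ≤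
          2 * cycleDist z + 1 := by
        have := card_cycleDist_le (d := d) z.valMinAbs.natAbs
        unfold cycleDist at this ⊢
        exact_mod_cast this
      have h3 : (0 : ℝ) < cycleDist z := by linarith
      calc _ ≤ (3 * cycleDist z) * (cycleDist z ^ 2)⁻¹ := by gcongr; linarith
        _ = 3 * (cycleDist z)⁻¹ := by field_simp
  have hterm : ∀ k : ZMod d × ZMod d, (cycleDist k.1 ^ 2 + cycleDist k.2 ^ 2)⁻¹ ≤
      (if cycleDist k.2 ≤ cycleDist k.1 then (cycleDist k.1 ^ 2)⁻¹ else 0) +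
      (if cycleDist k.1 ≤ cycleDist k.2 then (cycleDist k.2 ^ 2)⁻¹ else 0) := by
    have aux : ∀ a b : ℝ, 0 ≤ b → b ≤ a → (a ^ 2 + b ^ 2)⁻¹ ≤ (a ^ 2)⁻¹ := by
      intro a b hb hab
      rcases (hb.trans hab).eq_or_lt with h | h
      · have : b = 0 := by linarith
        simp [← h, this]
      · exact inv_anti₀ (by positivity) (by nlinarith)
    intro k
    have p1 : (0 : ℝ) ≤ (if cycleDist k.2 ≤ cycleDist k.1 then (cycleDist k.1 ^ 2)⁻¹ else 0) := by
      positivity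
    have p2 : (0 : ℝ) ≤ (if cycleDist k.1 ≤ cycleDist k.2 then (cycleDist k.2 ^ 2)⁻¹ else 0) := by
      positivity
    rcases le_total (cycleDist k.2) (cycleDist k.1) with h | h
    · have := aux _ _ (cycleDist_nonneg _) h
      rw [if_pos h]
      linarith
    · have := aux _ _ (cycleDist_nonneg _) h
      rw [add_comm] at this
      rw [if_pos h]
      linarith
  have hsum : ∑ z : ZMod d, 3 * (cycleDist z)⁻¹ ≤ 6 * (1 + Real.log d) := by
    rw [← Finset.mul_sum]
    have := sum_inv_cycleDist_le (d := d)
    linarith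
  have s1 : ∑ k : ZMod d × ZMod d,
      (if cycleDist k.2 ≤ cycleDist k.1 then (cycleDist k.1 ^ 2)⁻¹ else 0) ≤
      6 * (1 + Real.log d) := by
    rw [Fintype.sum_prod_type]
    exact (Finset.sum_le_sum fun z _ => half z).trans hsum
  have s2 : ∑ k : ZMod d × ZMod d,
      (if cycleDist k.1 ≤ cycleDist k.2 then (cycleDist k.2 ^ 2)⁻¹ else 0) ≤
      6 * (1 + Real.log d) := by
    rw [Fintype.sum_prod_type_right]
    exact (Finset.sum_le_sum fun z _ => half z).trans hsum
  refine (Finset.sum_le_sum fun k _ => hterm k).trans ?_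
  rw [Finset.sum_add_distrib]
  linarith

end Counting

/-! ### The expected time to reach `0` on the `d × d` torus -/

section Green

variable {d : ℕ} [NeZero d]

/-- The eigenvalue of `1 - P` at the frequency `k`. -/
noncomputable def torusGap (k : ZMod d × ZMod d) : ℝ := 2 / 5 * (2 - cosChar k.1 - cosChar k.2)

theorem le_torusGap (k : ZMod d × ZMod d) :
    16 / 5 * (cycleDist k.1 ^ 2 + cycleDist k.2 ^ 2) / (d : ℝ) ^ 2 ≤ torusGap k := by
  have h1 := le_one_sub_cosChar k.1
  have h2 := le_one_sub_cosChar k.2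
  unfold torusGap
  calc _ = 2 / 5 * (8 * cycleDist k.1 ^ 2 / (d : ℝ) ^ 2 + 8 * cycleDist k.2 ^ 2 / (d : ℝ) ^ 2) := by
        ring
    _ ≤ _ := by linarith

theorem torusGap_zero : torusGap (0 : ZMod d × ZMod d) = 0 := by
  simp [torusGap, cosChar_zero]
  norm_num

omit [NeZero d] in
theorem sq_add_sq_cycleDist_pos {k : ZMod d × ZMod d} (hk : k ≠ 0) :
    0 < cycleDist k.1 ^ 2 + cycleDist k.2 ^ 2 := by
  by_cases h1 : k.1 = 0
  · have h2 : k.2 ≠ 0 := fun h2 => hk (Prod.ext h1 h2)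
    have := cycleDist_pos h2
    positivity
  · have := cycleDist_pos h1
    positivity

theorem torusGap_pos {k : ZMod d × ZMod d} (hk : k ≠ 0) : 0 < torusGap k := by
  refine lt_of_lt_of_le ?_ (le_torusGap k)
  have h := sq_add_sq_cycleDist_pos hk
  have hd : (0 : ℝ) < d := by exact_mod_cast Nat.pos_of_ne_zero (NeZero.ne d)
  positivity

theorem torusGap_nonneg (k : ZMod d × ZMod d) : 0 ≤ torusGap k := by
  by_cases hk : k = 0
  · rw [hk, torusGap_zero]
  · exact (torusGap_pos hk).le

/-- The expected time for the walk on the `d × d` torus to go from `x` to `0`. -/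
noncomputable def torusGreen (x : ZMod d × ZMod d) : ℝ :=
  ∑ k : ZMod d × ZMod d, (1 - cosChar (k.1 * x.1 + k.2 * x.2)) / torusGap k

theorem torusGreen_nonneg (x : ZMod d × ZMod d) : 0 ≤ torusGreen x :=
  Finset.sum_nonneg fun k _ => div_nonneg
    (sub_nonneg.2 ((le_abs_self _).trans (abs_cosChar_le _))) (torusGap_nonneg k)

theorem torusGreen_le (hd : 2 ≤ d) (x : ZMod d × ZMod d) :
    torusGreen x ≤ 24 * ((d : ℝ) ^ 2 * Real.log d) := by
  have hd0 : (0 : ℝ) < d := by exact_mod_cast (by omega : 0 < d)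
  have h1 : ∀ k : ZMod d × ZMod d, (1 - cosChar (k.1 * x.1 + k.2 * x.2)) / torusGap k ≤
      5 / 8 * (d : ℝ) ^ 2 * (cycleDist k.1 ^ 2 + cycleDist k.2 ^ 2)⁻¹ := by
    intro k
    by_cases hk : k = 0
    -- Division by zero drops the zero frequency from the sum.
    · rw [hk, torusGap_zero, div_zero]; positivity
    · have hg := torusGap_pos hk
      have h2 : 1 - cosChar (k.1 * x.1 + k.2 * x.2) ≤ 2 := by
        have := neg_le_of_abs_le (abs_cosChar_le (k.1 * x.1 + k.2 * x.2))
        linarith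
      have h3 := le_torusGap k
      have h4 := sq_add_sq_cycleDist_pos hk
      calc _ ≤ 2 / torusGap k := by gcongr
        _ ≤ 2 / (16 / 5 * (cycleDist k.1 ^ 2 + cycleDist k.2 ^ 2) / (d : ℝ) ^ 2) := by gcongr
        _ = _ := by field_simp; norm_num
  refine (Finset.sum_le_sum fun k _ => h1 k).trans ?_
  rw [← Finset.mul_sum]
  have h5 := sum_inv_sq_le (d := d)
  -- Absorbs the `1` in `1 + log d` for `d ≥ 2`, leaving `5/8 · 12 · 3 = 22.5 ≤ 24`.
  have hlog : (1 : ℝ) / 2 ≤ Real.log d := by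
    have h6 : Real.log 2 ≤ Real.log d := Real.log_le_log two_pos (by exact_mod_cast hd)
    have := Real.log_two_gt_d9
    linarith
  calc _ ≤ 5 / 8 * (d : ℝ) ^ 2 * (12 * (1 + Real.log d)) := by gcongr
    _ ≤ 5 / 8 * (d : ℝ) ^ 2 * (12 * (2 * Real.log d + Real.log d)) := by gcongr; linarith
    _ ≤ _ := by
      have : 0 ≤ (d : ℝ) ^ 2 * Real.log d := by positivity
      linarith

/-- Applying `1 - P` multiplies each character by its gap, which cancels the denominator and leaves
`-cos` at every nonzero frequency. Orthogonality of characters at `x ≠ 0` makes these sum to `1`. -/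
theorem torusGreen_laplacian {x : ZMod d × ZMod d} (hx : x ≠ 0) :
    torusGreen x = 1 + (torusGreen x + torusGreen (x + (1, 0)) + torusGreen (x - (1, 0)) +
      torusGreen (x + (0, 1)) + torusGreen (x - (0, 1))) / 5 := by
  set θ : ZMod d × ZMod d → ZMod d := fun k => k.1 * x.1 + k.2 * x.2 with hθ
  -- At `k = 0` the right-hand side is `1 - 1 = 0`; writing it this way completes the character sum
  -- over all frequencies.
  have hterm : ∀ k : ZMod d × ZMod d,
      (1 - cosChar (θ k)) / torusGap k -
        ((1 - cosChar (θ k)) / torusGap k + (1 - cosChar (θ k + k.1)) / torusGap k +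
          (1 - cosChar (θ k - k.1)) / torusGap k + (1 - cosChar (θ k + k.2)) / torusGap k +
          (1 - cosChar (θ k - k.2)) / torusGap k) / 5 =
      (if k = 0 then 1 else 0) - cosChar (θ k) := by
    intro k
    by_cases hk : k = 0
    · rw [if_pos hk]
      have : θ k = 0 := by simp [hθ, hk]
      rw [this, cosChar_zero, hk, torusGap_zero]
      simp
    · rw [if_neg hk]
      have hg := (torusGap_pos hk).ne'
      have e1 := cosChar_add_add_sub (θ k) k.1
      have e2 := cosChar_add_add_sub (θ k) k.2
      field_simp
      unfold torusGap
      linear_combination e1 + e2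
  have hsum := Finset.sum_congr (rfl : (Finset.univ : Finset (ZMod d × ZMod d)) = Finset.univ)
    fun k _ => hterm k
  simp only [Finset.sum_sub_distrib, ← Finset.sum_div, Finset.sum_add_distrib] at hsum
  rw [Finset.sum_ite_eq', if_pos (Finset.mem_univ _), sum_cosChar x hx] at hsum
  have g1 : torusGreen (x + (1, 0)) = ∑ k, (1 - cosChar (θ k + k.1)) / torusGap k := by
    refine Finset.sum_congr rfl fun k _ => ?_
    simp only [hθ, Prod.fst_add, Prod.snd_add]
    ring_nf
  have g2 : torusGreen (x - (1, 0)) = ∑ k, (1 - cosChar (θ k - k.1)) / torusGap k := by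
    refine Finset.sum_congr rfl fun k _ => ?_
    simp only [hθ, Prod.fst_sub, Prod.snd_sub]
    ring_nf
  have g3 : torusGreen (x + (0, 1)) = ∑ k, (1 - cosChar (θ k + k.2)) / torusGap k := by
    refine Finset.sum_congr rfl fun k _ => ?_
    simp only [hθ, Prod.fst_add, Prod.snd_add]
    ring_nf
  have g4 : torusGreen (x - (0, 1)) = ∑ k, (1 - cosChar (θ k - k.2)) / torusGap k := by
    refine Finset.sum_congr rfl fun k _ => ?_
    simp only [hθ, Prod.fst_sub, Prod.snd_sub]
    ring_nf
  have g0 : torusGreen x = ∑ k, (1 - cosChar (θ k)) / torusGap k := rfl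
  rw [← g0, ← g1, ← g2, ← g3, ← g4] at hsum
  linarith

end Green

/-! ### Transfer to the `N × N` torus -/

section HittingBound

variable {d₁ k₁ d N : ℕ+}

/-- Only the sparse grid matters: `torusGreen` pulled back along reduction mod `d` satisfies `g = 1
+ P g` off its fibre over `0`, and enlarging the marked set only weakens the requirement. -/
theorem gridHT_le (hdN : (d : ℕ) ∣ (N : ℕ)) (hd : 2 ≤ (d : ℕ)) :
    gridHT d₁ k₁ d N ≤
      ENNReal.ofReal (24 * (((d : ℕ) : ℝ) ^ 2 * Real.log ((d : ℕ) : ℝ))) := by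
  let pr : Vertex (N : ℕ) → ZMod (d : ℕ) × ZMod (d : ℕ) := fun x =>
    (ZMod.castHom hdN (ZMod (d : ℕ)) x.1, ZMod.castHom hdN (ZMod (d : ℕ)) x.2)
  refine ReversibleChain.hittingTime_le _ _ (fun x => ENNReal.ofReal (torusGreen (pr x))) _ ?_ ?_
  · intro x hx
    have hne : pr x ≠ 0 := by
      intro h0
      refine hx (Finset.mem_union_right _ (mem_subgrid_of_castHom_eq_zero _ hdN ?_ ?_))
      · exact congrArg Prod.fst h0
      · exact congrArg Prod.snd h0
    have e1 : ∑ y, ENNReal.ofReal ((torusWalk (N : ℕ)).P x y) * ENNReal.ofReal (torusGreen (pr y)) =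
        ENNReal.ofReal (∑ y, torusMatrix (N : ℕ) x y * torusGreen (pr y)) := by
      rw [ENNReal.ofReal_sum_of_nonneg fun y _ =>
        mul_nonneg (torusMatrix_nonneg _ x y) (torusGreen_nonneg _)]
      exact Finset.sum_congr rfl fun y _ =>
        (ENNReal.ofReal_mul (torusMatrix_nonneg (N : ℕ) x y)).symm
    rw [e1, ← ENNReal.ofReal_one, ← ENNReal.ofReal_add zero_le_one
      (Finset.sum_nonneg fun y _ => mul_nonneg (torusMatrix_nonneg _ x y) (torusGreen_nonneg _))]
    refine ENNReal.ofReal_le_ofReal (le_of_eq ?_)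
    rw [sum_torusMatrix_mul (N : ℕ) x fun y => torusGreen (pr y)]
    have p1 : pr (x + (1, 0)) = pr x + (1, 0) := by
      refine Prod.ext ?_ ?_ <;> simp only [pr, Prod.fst_add, Prod.snd_add, map_add, map_one, map_zero]
    have p2 : pr (x - (1, 0)) = pr x - (1, 0) := by
      refine Prod.ext ?_ ?_ <;> simp only [pr, Prod.fst_sub, Prod.snd_sub, map_sub, map_one, map_zero]
    have p3 : pr (x + (0, 1)) = pr x + (0, 1) := by
      refine Prod.ext ?_ ?_ <;> simp only [pr, Prod.fst_add, Prod.snd_add, map_add, map_one, map_zero]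
    have p4 : pr (x - (0, 1)) = pr x - (0, 1) := by
      refine Prod.ext ?_ ?_ <;> simp only [pr, Prod.fst_sub, Prod.snd_sub, map_sub, map_one, map_zero]
    simp only [p1, p2, p3, p4]
    exact (torusGreen_laplacian hne).symm
  · intro x
    exact ENNReal.ofReal_le_ofReal (torusGreen_le hd _)

theorem gridHT_toReal_pos (hdense : 32 * ((k₁ : ℕ) * (d₁ : ℕ)) ≤ (N : ℕ))
    (hsparse : 8 * ((N : ℕ) / (d : ℕ)) ≤ (k₁ : ℕ)) (hdN : (d : ℕ) ∣ (N : ℕ)) (hd : 2 ≤ (d : ℕ)) :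
    0 < (gridHT d₁ k₁ d N).toReal := by
  have hlt := card_markedSet_lt (N := (N : ℕ)) (d := (d : ℕ)) d₁.pos hdense hsparse
  obtain ⟨x, hx⟩ : ∃ x, x ∉ markedSet (N : ℕ) d₁ k₁ d := by
    by_contra! hall
    rw [Finset.eq_univ_iff_forall.2 hall, Finset.card_univ, Fintype.card_prod, ZMod.card] at hlt
    rw [sq] at hlt
    exact lt_irrefl _ hlt
  have h1 := (torusWalk (N : ℕ)).le_hittingTime _ hx
  refine ENNReal.toReal_pos (ne_of_gt (lt_of_lt_of_le ?_ h1))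
    (ne_top_of_le_ne_top ENNReal.ofReal_ne_top (gridHT_le hdN hd))
  refine ENNReal.ofReal_pos.2 ?_
  change (0 : ℝ) < 1 / ((N : ℕ) : ℝ) ^ 2
  have : (0 : ℝ) < ((N : ℕ) : ℝ) := by exact_mod_cast N.pos
  positivity

end HittingBound

end SpatialSearch

namespace SpatialSearch

/-! ### From the asymptotic regime to explicit inequalities -/

section Asymptotic

variable {d₁ k₁ d N : ℕ → ℕ+}

theorem GapRegime.eventually_bounds (h : GapRegime d₁ k₁ d N) : ∀ᶠ a in atTop,
    32 * ((k₁ a : ℕ) * (d₁ a : ℕ)) ≤ (N a : ℕ) ∧ 8 * ((N a : ℕ) / (d a : ℕ)) ≤ (k₁ a : ℕ) ∧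
      2 ≤ (d a : ℕ) := by
  filter_upwards [h.dense_small.bound (c := 1 / 32) (by norm_num),
    h.sparse_few.bound (c := 1 / 8) (by norm_num)] with a h1 h2
  rw [Real.norm_of_nonneg (by positivity), Real.norm_of_nonneg (by positivity)] at h1 h2
  have e1 : 32 * ((k₁ a : ℕ) * (d₁ a : ℕ)) ≤ (N a : ℕ) := by
    have : (32 : ℝ) * (((k₁ a : ℕ) : ℝ) * ((d₁ a : ℕ) : ℝ)) ≤ ((N a : ℕ) : ℝ) := by linarith
    exact_mod_cast this
  have e2 : 8 * (N a : ℕ) ≤ (k₁ a : ℕ) * (d a : ℕ) := by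
    have : (8 : ℝ) * ((N a : ℕ) : ℝ) ≤ ((k₁ a : ℕ) : ℝ) * ((d a : ℕ) : ℝ) := by linarith
    exact_mod_cast this
  refine ⟨e1, ?_, ?_⟩
  · refine Nat.le_of_mul_le_mul_right ?_ (d a).pos
    rw [mul_assoc, Nat.div_mul_cancel (h.dvd_size a)]
    exact e2
  -- If `d = 1`, then `8 N ≤ k₁ ≤ k₁ d₁ ≤ N / 32`, which is impossible.
  · by_contra hlt
    have hd : (d a : ℕ) = 1 := by have := (d a).pos; omega
    rw [hd, mul_one] at e2
    have h3 : (k₁ a : ℕ) ≤ (k₁ a : ℕ) * (d₁ a : ℕ) := Nat.le_mul_of_pos_right _ (d₁ a).pos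
    have := (N a).pos
    omega

theorem toReal_gridHT_le {d₁ k₁ d N : ℕ+} (hdN : (d : ℕ) ∣ (N : ℕ)) (hd : 2 ≤ (d : ℕ)) :
    (gridHT d₁ k₁ d N).toReal ≤ 24 * (((d : ℕ) : ℝ) ^ 2 * Real.log ((d : ℕ) : ℝ)) :=
  ENNReal.toReal_le_of_le_ofReal (by positivity) (gridHT_le hdN hd)

theorem GapRegime.isLittleO_gridHT (h : GapRegime d₁ k₁ d N) :
    (fun a => (gridHT (d₁ a) (k₁ a) (d a) (N a)).toReal) =o[atTop]
      fun a => gridExtendedHT (d₁ a) (k₁ a) (d a) (N a) := by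
  have h1 : (fun a => (gridHT (d₁ a) (k₁ a) (d a) (N a)).toReal) =O[atTop]
      fun a => ((d a : ℕ) : ℝ) ^ 2 * Real.log ((d a : ℕ) : ℝ) := by
    refine IsBigO.of_bound 24 ?_
    filter_upwards [h.eventually_bounds] with a ha
    rw [Real.norm_of_nonneg ENNReal.toReal_nonneg, Real.norm_of_nonneg (by positivity)]
    exact toReal_gridHT_le (h.dvd_size a) ha.2.2
  have h2 : (fun a => ((N a : ℕ) : ℝ) ^ 2) =O[atTop]
      fun a => gridExtendedHT (d₁ a) (k₁ a) (d a) (N a) := by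
    refine IsBigO.of_bound 128 ?_
    filter_upwards [h.eventually_bounds] with a ha
    have := (extendedHT_lower_bound ha.1 ha.2.1).2
    rw [Real.norm_of_nonneg (by positivity)]
    refine le_trans ?_ (mul_le_mul_of_nonneg_left (le_abs_self _) (by norm_num))
    linarith
  exact (h1.trans_isLittleO h.sparse_hit).trans_isBigO h2

end Asymptotic

/-! ### The explicit family with an almost quadratic gap -/

section Example

/-- The scale `max a 1` of the example, a positive integer. -/
def gapScale (a : ℕ) : ℕ+ := ⟨max a 1, by positivity⟩

theorem gapScale_of_two_le {a : ℕ} (ha : 2 ≤ a) : (gapScale a : ℕ) = a := by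
  simp only [gapScale, PNat.mk_coe]
  omega

theorem eventually_le_mul_gapScale {c : ℝ} (hc : 0 < c) :
    ∀ᶠ a in atTop, 1 ≤ c * ((gapScale a : ℕ) : ℝ) := by
  filter_upwards [(tendsto_natCast_atTop_atTop (R := ℝ)).eventually_ge_atTop (1 / c)] with a ha
  rw [div_le_iff₀' hc] at ha
  refine ha.trans (mul_le_mul_of_nonneg_left ?_ hc.le)
  simp only [gapScale, PNat.mk_coe]
  exact_mod_cast le_max_left a 1

/-- With `b` the scale and `E = 2 ^ b²`, the first two ratios are exactly `1 / b`, and the third is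
at most `b² / E² ≤ 1 / b` as `E ≥ b²`. So each condition reduces to `1 ≤ c b`. -/
theorem gapRegime_gapScale : GapRegime (fun _ => 1)
    (fun a => gapScale a * 2 ^ (gapScale a : ℕ) ^ 2) (fun a => gapScale a ^ 2)
    (fun a => gapScale a ^ 2 * 2 ^ (gapScale a : ℕ) ^ 2) := by
  have hpos : ∀ a, (1 : ℝ) ≤ ((gapScale a : ℕ) : ℝ) := fun a => by
    exact_mod_cast (gapScale a).pos
  refine ⟨?_, ?_, ?_, fun a => by simp, fun a => by simp⟩
  · refine isLittleO_iff.2 fun c hc => ?_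
    filter_upwards [eventually_le_mul_gapScale hc] with a ha
    rw [Real.norm_of_nonneg (by positivity), Real.norm_of_nonneg (by positivity)]
    have := hpos a
    push_cast
    set b : ℝ := ((gapScale a : ℕ) : ℝ)
    set E : ℝ := 2 ^ (gapScale a : ℕ) ^ 2
    have hbE : 0 ≤ b * E := by positivity
    calc b * E * 1 = 1 * (b * E) := by ring
      _ ≤ (c * b) * (b * E) := mul_le_mul_of_nonneg_right ha hbE
      _ = _ := by ring
  · refine isLittleO_iff.2 fun c hc => ?_
    filter_upwards [eventually_le_mul_gapScale hc] with a ha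
    rw [Real.norm_of_nonneg (by positivity), Real.norm_of_nonneg (by positivity)]
    have := hpos a
    push_cast
    set b : ℝ := ((gapScale a : ℕ) : ℝ)
    set E : ℝ := 2 ^ (gapScale a : ℕ) ^ 2
    have hbE : 0 ≤ b ^ 2 * E := by positivity
    calc b ^ 2 * E = 1 * (b ^ 2 * E) := by ring
      _ ≤ (c * b) * (b ^ 2 * E) := mul_le_mul_of_nonneg_right ha hbE
      _ = _ := by ring
  · refine isLittleO_iff.2 fun c hc => ?_
    filter_upwards [eventually_le_mul_gapScale hc] with a ha
    rw [Real.norm_of_nonneg (by positivity), Real.norm_of_nonneg (by positivity)]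
    have hb := hpos a
    have hE : ((gapScale a : ℕ) : ℝ) ^ 2 ≤ 2 ^ (gapScale a : ℕ) ^ 2 := by
      exact_mod_cast (Nat.lt_two_pow_self (n := (gapScale a : ℕ) ^ 2)).le
    push_cast
    set b : ℝ := ((gapScale a : ℕ) : ℝ)
    set E : ℝ := 2 ^ (gapScale a : ℕ) ^ 2
    have hlog : Real.log (b ^ 2) ≤ b ^ 2 := by
      have := Real.log_le_sub_one_of_pos (x := b ^ 2) (by positivity)
      linarith
    have hE2 : b ^ 3 ≤ E ^ 2 := calc
      b ^ 3 ≤ b ^ 4 := pow_le_pow_right₀ hb (by norm_num)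
      _ = (b ^ 2) ^ 2 := by ring
      _ ≤ E ^ 2 := pow_le_pow_left₀ (by positivity) hE 2
    calc (b ^ 2) ^ 2 * Real.log (b ^ 2) ≤ (b ^ 2) ^ 2 * b ^ 2 := by gcongr
      _ = 1 * ((b ^ 2) ^ 2 * b ^ 2) := (one_mul _).symm
      _ ≤ (c * b) * ((b ^ 2) ^ 2 * b ^ 2) := mul_le_mul_of_nonneg_right ha (by positivity)
      _ = c * ((b ^ 2) ^ 2 * b ^ 3) := by ring
      _ ≤ c * ((b ^ 2) ^ 2 * E ^ 2) := by gcongr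
      _ = _ := by ring

/-- Meant for `d = b²` and `L = log N`: `d ≤ 2 L` and `log d = 2 log b ≤ 2 log L`, giving the
constant `4 · 2 = 8`. -/
theorem sq_mul_log_le_log_size {b : ℝ} (hb : 2 ≤ b) {L : ℝ}
    (hL : b ^ 2 * Real.log 2 ≤ L) :
    0 < L ^ 2 * Real.log L ∧ (b ^ 2) ^ 2 * Real.log (b ^ 2) ≤ 8 * (L ^ 2 * Real.log L) := by
  have h2 := Real.log_two_gt_d9
  have hL' : b ^ 2 / 2 ≤ L := by nlinarith
  have hbL : b ≤ L := by nlinarith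
  have hlogb : Real.log b ≤ Real.log L := Real.log_le_log (by linarith) hbL
  have hlogb0 : 0 < Real.log b := Real.log_pos (by linarith)
  have hLpos : 0 < L := by linarith
  refine ⟨mul_pos (by positivity) (hlogb0.trans_le hlogb), ?_⟩
  calc (b ^ 2) ^ 2 * Real.log (b ^ 2) = 8 * ((b ^ 2 / 2) ^ 2 * Real.log b) := by
        rw [Real.log_pow]; push_cast; ring
    _ ≤ 8 * (L ^ 2 * Real.log L) := by gcongr

end Example

end SpatialSearch

theorem lemma3p2 :
    (∀ d₁ k₁ d N : ℕ → ℕ+, SpatialSearch.GapRegime d₁ k₁ d N →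
      -- the limit defining the extended hitting time exists
      (∀ᶠ a in atTop, Tendsto (SpatialSearch.gridInterpolatedHT (d₁ a) (k₁ a) (d a) (N a))
        (𝓝[<] 1) (𝓝 (SpatialSearch.gridExtendedHT (d₁ a) (k₁ a) (d a) (N a)))) ∧
      -- `HT⁺ = Ω(N²)`
      (∃ c : ℝ, 0 < c ∧ ∀ᶠ a in atTop,
        c * ((N a : ℕ) : ℝ) ^ 2 ≤
          SpatialSearch.gridExtendedHT (d₁ a) (k₁ a) (d a) (N a)) ∧
      -- `HT = O(d² log d)`, in particular `HT` is finite
      (∃ K : ℝ, ∀ᶠ a in atTop,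
        SpatialSearch.gridHT (d₁ a) (k₁ a) (d a) (N a) ≤
          ENNReal.ofReal (K * (((d a : ℕ) : ℝ) ^ 2 * Real.log ((d a : ℕ) : ℝ)))) ∧
      -- `HT = o(HT⁺)`
      (fun a => (SpatialSearch.gridHT (d₁ a) (k₁ a) (d a) (N a)).toReal) =o[atTop]
        (fun a => SpatialSearch.gridExtendedHT (d₁ a) (k₁ a) (d a) (N a))) ∧
    -- an `N²` gap, up to factors polylogarithmic in `N`, is attained
    (∃ d₁ k₁ d N : ℕ → ℕ+,
      (∀ a, 2 ≤ a → (d₁ a : ℕ) = 1 ∧ (k₁ a : ℕ) = a * 2 ^ a ^ 2 ∧ (d a : ℕ) = a ^ 2 ∧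
        (N a : ℕ) = a ^ 2 * 2 ^ a ^ 2) ∧
      SpatialSearch.GapRegime d₁ k₁ d N ∧
      ∃ c : ℝ, 0 < c ∧ ∀ᶠ a in atTop,
        0 < (SpatialSearch.gridHT (d₁ a) (k₁ a) (d a) (N a)).toReal ∧
        c * (((N a : ℕ) : ℝ) ^ 2 /
            (Real.log ((N a : ℕ) : ℝ) ^ 2 * Real.log (Real.log ((N a : ℕ) : ℝ)))) ≤
          SpatialSearch.gridExtendedHT (d₁ a) (k₁ a) (d a) (N a) /
            (SpatialSearch.gridHT (d₁ a) (k₁ a) (d a) (N a)).toReal) := by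
  refine ⟨fun d₁ k₁ d N h => ⟨?_, ⟨1 / 128, by norm_num, ?_⟩, ⟨24, ?_⟩, h.isLittleO_gridHT⟩, ?_⟩
  · filter_upwards [h.eventually_bounds] with a ha
    exact (SpatialSearch.extendedHT_lower_bound ha.1 ha.2.1).1
  · filter_upwards [h.eventually_bounds] with a ha
    exact (SpatialSearch.extendedHT_lower_bound ha.1 ha.2.1).2
  · filter_upwards [h.eventually_bounds] with a ha
    exact SpatialSearch.gridHT_le (h.dvd_size a) ha.2.2
  -- The constant is `24576 = 128 · 24 · 8`: from the lower bound on `HT⁺`, the upper bound on `HT`,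
  -- and the comparison of `d² log d` with `log² N · log log N`.
  · refine ⟨_, _, _, _, fun a ha => ?_, SpatialSearch.gapRegime_gapScale, 1 / 24576, by norm_num, ?_⟩
    · simp [SpatialSearch.gapScale_of_two_le ha]
    · filter_upwards [SpatialSearch.gapRegime_gapScale.eventually_bounds,
        eventually_ge_atTop 2] with a ha ha2
      have hpos := SpatialSearch.gridHT_toReal_pos ha.1 ha.2.1
        (SpatialSearch.gapRegime_gapScale.dvd_size a) ha.2.2
      refine ⟨hpos, ?_⟩
      have hlow := (SpatialSearch.extendedHT_lower_bound ha.1 ha.2.1).2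
      have hup := SpatialSearch.toReal_gridHT_le (d₁ := 1)
        (k₁ := SpatialSearch.gapScale a * 2 ^ (SpatialSearch.gapScale a : ℕ) ^ 2)
        (SpatialSearch.gapRegime_gapScale.dvd_size a) ha.2.2
      have hb : (2 : ℝ) ≤ ((SpatialSearch.gapScale a : ℕ) : ℝ) := by
        rw [SpatialSearch.gapScale_of_two_le ha2]; exact_mod_cast ha2
      set b : ℝ := ((SpatialSearch.gapScale a : ℕ) : ℝ) with hbdef
      set n : ℕ+ := SpatialSearch.gapScale a ^ 2 * 2 ^ (SpatialSearch.gapScale a : ℕ) ^ 2 with hn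
      have hL : b ^ 2 * Real.log 2 ≤ Real.log ((n : ℕ) : ℝ) := by
        have e : b ^ 2 * Real.log 2 = Real.log (2 ^ (SpatialSearch.gapScale a : ℕ) ^ 2) := by
          rw [Real.log_pow, hbdef]; push_cast; ring
        rw [e, hn]
        push_cast
        refine Real.log_le_log (by positivity) (le_mul_of_one_le_left (by positivity) ?_)
        rw [← hbdef]
        nlinarith
      obtain ⟨hW, hle⟩ := SpatialSearch.sq_mul_log_le_log_size hb hL
      set W := Real.log ((n : ℕ) : ℝ) ^ 2 * Real.log (Real.log ((n : ℕ) : ℝ)) with hWdef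
      have hd : (((SpatialSearch.gapScale a ^ 2 : ℕ+) : ℕ) : ℝ) = b ^ 2 := by
        rw [hbdef]; push_cast; ring
      rw [hd] at hup
      calc 1 / 24576 * (((n : ℕ) : ℝ) ^ 2 / W) = 1 / 128 * ((n : ℕ) : ℝ) ^ 2 / (192 * W) := by
            field_simp; norm_num
        _ ≤ _ := div_le_div₀ (le_trans (by positivity) hlow) hlow hpos (by linarith)
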